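/- For $\gamma\ge 0$ consider Problem $1$-$\gamma$ for the NOT gate: over measurable bounded controls $u$ on $[0,1]$, minimize $$C=\frac12\int_0^1u(t)^2\,dt+\frac{\gamma}{2}\bigl(S_z(1)^2+S_x(1)^2\bigr)$$ subject to $\dot\theta=u$, $\dot S_z=\cos 2\theta$, $\dot S_x=\sin 2\theta$, $\theta(0)=S_z(0)=S_x(0)=0$, $\theta(1)=\frac{\pi}{2}$, with $S_z(1),S_x(1)$ free. An \emph{extremal} is a control-trajectory pair satisfying these constraints and the Pontryagin maximum principle, that is: there are a constant $\mu_0\le 0$ and a costate $(\lambda_\theta,\lambda_z,\lambda_x)$ on $[0,1]$, not both identically zero, such that, for $$\hat H=\lambda_\theta v+\lambda_z\cos2\theta+\lambda_x\sin2\theta+\mu_0\bigl(\tfrac12v^2+\gamma(S_z\cos2\theta+S_x\sin2\theta)\bigr),$$ $v=u(t)$ maximizes $\hat H$ over $v\in\mathbb R$ for almost every $t$, $\dot\lambda_\theta=-\partial_\theta\hat H$, $\dot\lambda_z=-\partial_{S_z}\hat H$, $\dot\lambda_x=-\partial_{S_x}\hat H$, $\hat H$ is constant along the trajectory (almost everywhere),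 and $\lambda_z(1)=\lambda_x(1)=0$. The control of an extremal agrees almost everywhere with a continuous function, and $u(0)$ denotes the value of that function at $0$. Put $$I(k)=\int_0^{\pi/2}\frac{dx}{\sqrt{k+\sin x}},\qquad J(k)=\int_0^{\pi/2}\frac{\sin x\,dx}{\sqrt{k+\sin x}}\qquad(k\ge 0),$$ $$I_1(k)=2\int_{-\arcsin k}^{0}\frac{dx}{\sqrt{k+\sin x}}+I(k),\qquad J_1(k)=2\int_{-\arcsin k}^{0}\frac{\sin x\,dx}{\sqrt{k+\sin x}}+J(k)\qquad(0\le k<1),$$ and $\gamma_c=\frac{I(0)^3}{2J(0)}$. The \emph{simplest extremal} for $\gamma$ is the extremal with $u(0)=c$ and $S_x(1)=S$, where: * if $\gamma=0$: $c=\frac{\pi}{2}$, $S=\frac{2}{\pi}$; * if $0<\gamma<\gamma_c$: $c=\sqrt{k\,I(k)^2}$, $S=\frac{J(k)}{I(k)}$, with $k>0$ the solution of $2\gamma J(k)=I(k)^3$; * if $\gamma=\gamma_c$: $c=0$, $S=\frac{J(0)}{I(0)}$; * if $\gamma>\gamma_c$: $c=-\sqrt{k\,I_1(k)^2}$, $S=\frac{I_1(k)^2}{2\gamma}$,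 with $k\in(0,1)$ the solution of $2\gamma J_1(k)=I_1(k)^3$. **Proposition.** For every $\gamma\ge0$ the simplest extremal exists, and no extremal with $u(0)<0$ has a cost lower than that of the simplest extremal. -/

import Mathlib

open MeasureTheory

noncomputable section

namespace NotGate

/-- A control `u` together with the nominal angle `θ` and the two components `Sz`, `Sx` of the
first order sensitivity; only the values on the time interval `[0, 1]` matter. -/
structure Trajectory where
  u : ℝ → ℝ
  θ : ℝ → ℝ
  Sz : ℝ → ℝ
  Sx : ℝ → ℝ

/-- `p` is a control-trajectory pair of the system `θ' = u`, `Sz' = cos 2θ`, `Sx' = sin 2θ` on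
`[0, 1]`, starting at `(0, 0, 0)` and with `θ 1 = π / 2` (`Sz 1` and `Sx 1` are free).  Controls
are measurable and bounded, and the differential equations hold in the Carathéodory sense, that is,
in integrated form. -/
structure IsAdmissible (p : Trajectory) : Prop where
  measurable_u : AEMeasurable p.u (volume.restrict (Set.Icc 0 1))
  bounded_u : ∃ M : ℝ, ∀ t ∈ Set.Icc (0 : ℝ) 1, |p.u t| ≤ M
  θ_eq : ∀ t ∈ Set.Icc (0 : ℝ) 1, p.θ t = ∫ s in (0 : ℝ)..t, p.u s
  Sz_eq : ∀ t ∈ Set.Icc (0 : ℝ) 1, p.Sz t = ∫ s in (0 : ℝ)..t, Real.cos (2 * p.θ s)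
  Sx_eq : ∀ t ∈ Set.Icc (0 : ℝ) 1, p.Sx t = ∫ s in (0 : ℝ)..t, Real.sin (2 * p.θ s)
  θ_final : p.θ 1 = Real.pi / 2

/-- The cost `C(γ)`: energy plus `γ` times the first order sensitivity cost. -/
def cost (γ : ℝ) (p : Trajectory) : ℝ :=
  (1 / 2) * (∫ t in (0 : ℝ)..1, p.u t ^ 2) + γ * ((1 / 2) * (p.Sz 1 ^ 2 + p.Sx 1 ^ 2))

/-- The control Hamiltonian of the maximum principle for the cost in Lagrange form, i.e. with
running cost `v² / 2 + γ (Sz cos 2θ + Sx sin 2θ)`. -/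
def hamiltonian (γ μ₀ lθ lz lx θ Sz Sx v : ℝ) : ℝ :=
  lθ * v + lz * Real.cos (2 * θ) + lx * Real.sin (2 * θ) +
    μ₀ * (v ^ 2 / 2 + γ * (Sz * Real.cos (2 * θ) + Sx * Real.sin (2 * θ)))

/-- The conditions of the Pontryagin maximum principle for the pair `p`, with multiplier `μ₀`
and costate `(lθ, lz, lx)`.  The right-hand sides of the costate equations are minus the partial
derivatives of the Hamiltonian in `θ`, `Sz`, `Sx`; they are continuous in time, so a Carathéodory
solution is the same as a solution that is differentiable at every time of `[0, 1]`. -/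
structure IsPMPMultiplier (γ : ℝ) (p : Trajectory) (μ₀ : ℝ) (lθ lz lx : ℝ → ℝ) : Prop where
  nonpos : μ₀ ≤ 0
  nontrivial : μ₀ ≠ 0 ∨ ∃ t ∈ Set.Icc (0 : ℝ) 1, lθ t ≠ 0 ∨ lz t ≠ 0 ∨ lx t ≠ 0
  maximality : ∀ᵐ t ∂(volume.restrict (Set.Icc (0 : ℝ) 1)), ∀ v : ℝ,
    hamiltonian γ μ₀ (lθ t) (lz t) (lx t) (p.θ t) (p.Sz t) (p.Sx t) v ≤
      hamiltonian γ μ₀ (lθ t) (lz t) (lx t) (p.θ t) (p.Sz t) (p.Sx t) (p.u t)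
  costate_θ : ∀ t ∈ Set.Icc (0 : ℝ) 1, HasDerivWithinAt lθ
    (2 * (lz t + μ₀ * γ * p.Sz t) * Real.sin (2 * p.θ t) -
      2 * (lx t + μ₀ * γ * p.Sx t) * Real.cos (2 * p.θ t)) (Set.Icc 0 1) t
  costate_z : ∀ t ∈ Set.Icc (0 : ℝ) 1, HasDerivWithinAt lz
    (-(μ₀ * γ * Real.cos (2 * p.θ t))) (Set.Icc 0 1) t
  costate_x : ∀ t ∈ Set.Icc (0 : ℝ) 1, HasDerivWithinAt lx
    (-(μ₀ * γ * Real.sin (2 * p.θ t))) (Set.Icc 0 1) t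
  constancy : ∃ h : ℝ, ∀ᵐ t ∂(volume.restrict (Set.Icc (0 : ℝ) 1)),
    hamiltonian γ μ₀ (lθ t) (lz t) (lx t) (p.θ t) (p.Sz t) (p.Sx t) (p.u t) = h
  transversality_z : lz 1 = 0
  transversality_x : lx 1 = 0

/-- An extremal: an admissible pair that satisfies the maximum principle. -/
def IsExtremal (γ : ℝ) (p : Trajectory) : Prop :=
  IsAdmissible p ∧ ∃ (μ₀ : ℝ) (lθ lz lx : ℝ → ℝ), IsPMPMultiplier γ p μ₀ lθ lz lx

/-- `u(0) = c`.  A control is determined up to a null set, and `u(0)` is the value at `0` of its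
continuous representative on `[0, 1]` (the control of an extremal always has one). -/
def HasInitialControl (p : Trajectory) (c : ℝ) : Prop :=
  ∃ w : ℝ → ℝ, ContinuousOn w (Set.Icc 0 1) ∧
    p.u =ᵐ[volume.restrict (Set.Icc 0 1)] w ∧ w 0 = c

def I (k : ℝ) : ℝ :=
  ∫ x in (0 : ℝ)..(Real.pi / 2), 1 / Real.sqrt (k + Real.sin x)

def J (k : ℝ) : ℝ :=
  ∫ x in (0 : ℝ)..(Real.pi / 2), Real.sin x / Real.sqrt (k + Real.sin x)

def I₁ (k : ℝ) : ℝ :=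
  2 * (∫ x in (-Real.arcsin k)..0, 1 / Real.sqrt (k + Real.sin x)) + I k

def J₁ (k : ℝ) : ℝ :=
  2 * (∫ x in (-Real.arcsin k)..0, Real.sin x / Real.sqrt (k + Real.sin x)) + J k

/-- The critical weight, above which the simplest extremal switches sign. -/
def γc : ℝ := I 0 ^ 3 / (2 * J 0)

/-- `(c, S)` are the parameters `u(0) = c` and `Sx(1) = S` of the simplest extremal for the
weight `γ`. -/
def IsSimplestParam (γ c S : ℝ) : Prop :=
  (γ = 0 ∧ c = Real.pi / 2 ∧ S = 2 / Real.pi) ∨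
  (0 < γ ∧ γ < γc ∧ ∃ k : ℝ, 0 < k ∧ 2 * γ * J k = I k ^ 3 ∧
    c = Real.sqrt (k * I k ^ 2) ∧ S = J k / I k) ∨
  (γ = γc ∧ c = 0 ∧ S = J 0 / I 0) ∨
  (γc < γ ∧ ∃ k : ℝ, 0 < k ∧ k < 1 ∧ 2 * γ * J₁ k = I₁ k ^ 3 ∧
    c = -Real.sqrt (k * I₁ k ^ 2) ∧ S = I₁ k ^ 2 / (2 * γ))

/-- The simplest extremal for the weight `γ`: the extremal with the parameters above. -/
def IsSimplestExtremal (γ : ℝ) (p : Trajectory) : Prop :=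
  IsExtremal γ p ∧ ∃ c S : ℝ, IsSimplestParam γ c S ∧ HasInitialControl p c ∧ p.Sx 1 = S

end NotGate

end

/-! The maximum principle has no abnormal extremals. Eliminating the costate turns an extremal into
a pendulum equation for `2θ`. Integrating that equation shows `u(1) = u(0) = c`, and the energy
integral then forces `γ Sz(1) = 0`. Hence, for `γ > 0`, `u² = c² + σ sin 2θ` with `σ = 2γ Sx(1)`,
and the cost depends on `c` and `Sx(1)` only.

If `c < 0`, the angle `2θ` must turn below `0` and above `π`, which forces `c² < σ`. With `k = c²/σ`
and `r = √σ`, the turning angles are `-arcsin k` and `π + arcsin k`, and the cost is `k r²/2 +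
3r⁴/(8γ)`. The path visits both turning angles, so its length in the metric `dx/√(k + sin x)` gives
`I₁ k ≤ r`. Its length in the metric `√(k + sin x) dx` gives `k I₁ + J₁ ≤ r (k + r²/(2γ))`
(`IsPendulum.exists_cost_eq`).

For `0 < γ ≤ γc` the first bound suffices: `r ≥ I₁ k ≥ I 0`, while the simplest extremal costs at
most `3 I(0)⁴/(8γ)` (`cost_family_le`). For `γ > γc` the simplest extremal satisfies the two bounds
with equality at some `l`. The function `k I₁ + J₁` is convex with slope `I₁/2` (`I₁_tangent`), so
comparing with its tangent at `l` and completing squares gives the inequality. For `γ = 0` the only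
initial control is `π/2`.

Existence comes from the intermediate value theorem for `k` and from inverting the travel time of a
scalar autonomous equation. The variable `ψ` with `k + sin x = (1 + k) sin² ψ` removes the
singularities at the turning points. -/

noncomputable section

namespace NotGate

/-! ### Uniformization of the elliptic integrals. -/

/-- The angle `x` written in terms of the uniformizing variable `ψ`, so that
`k + sin x = (1 + k) sin² ψ`. -/
def angle (k ψ : ℝ) : ℝ :=
  Real.pi / 2 - 2 * Real.arcsin (Real.sqrt ((1 + k) / 2) * Real.cos ψ)

/-- The value of `sin` at `angle k ψ`. -/
def sinAngle (k ψ : ℝ) : ℝ := 1 - (1 + k) * Real.cos ψ ^ 2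

/-- The density of the time of travel in the uniformizing variable. -/
def density (k ψ : ℝ) : ℝ := 2 / Real.sqrt (2 - (1 + k) * Real.cos ψ ^ 2)

theorem radicand_pos {k : ℝ} (h0 : -1 ≤ k) (h1 : k < 1) (ψ : ℝ) :
    0 < 2 - (1 + k) * Real.cos ψ ^ 2 := by
  nlinarith [Real.sin_sq_add_cos_sq ψ, sq_nonneg (Real.sin ψ), sq_nonneg (Real.cos ψ)]

theorem density_pos {k : ℝ} (h0 : -1 ≤ k) (h1 : k < 1) (ψ : ℝ) : 0 < density k ψ :=
  div_pos two_pos (Real.sqrt_pos.2 (radicand_pos h0 h1 ψ))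

theorem continuous_density {k : ℝ} (h0 : -1 ≤ k) (h1 : k < 1) : Continuous (density k) := by
  unfold density
  refine continuous_const.div (by fun_prop) fun ψ => ?_
  exact (Real.sqrt_pos.2 (radicand_pos h0 h1 ψ)).ne'

theorem continuous_sinAngle (k : ℝ) : Continuous (sinAngle k) := by
  unfold sinAngle
  fun_prop

theorem abs_sqrt_mul_cos_lt {k : ℝ} (h0 : -1 ≤ k) (h1 : k < 1) (ψ : ℝ) :
    |Real.sqrt ((1 + k) / 2) * Real.cos ψ| < 1 := by
  rw [← sq_lt_one_iff_abs_lt_one, mul_pow, Real.sq_sqrt (by linarith)]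
  linarith [radicand_pos h0 h1 ψ]

theorem sin_angle {k : ℝ} (h0 : -1 ≤ k) (h1 : k < 1) (ψ : ℝ) :
    Real.sin (angle k ψ) = sinAngle k ψ := by
  have h := abs_lt.1 (abs_sqrt_mul_cos_lt h0 h1 ψ)
  unfold angle sinAngle
  rw [Real.sin_pi_div_two_sub, Real.cos_two_mul, Real.cos_sq',
    Real.sin_arcsin h.1.le h.2.le, mul_pow, Real.sq_sqrt (by linarith)]
  ring

theorem add_sinAngle (k ψ : ℝ) : k + sinAngle k ψ = (1 + k) * Real.sin ψ ^ 2 := by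
  unfold sinAngle
  rw [Real.sin_sq]
  ring

theorem hasDerivAt_angle {k : ℝ} (h0 : -1 ≤ k) (h1 : k < 1) (ψ : ℝ) :
    HasDerivAt (angle k) (Real.sqrt (1 + k) * Real.sin ψ * density k ψ) ψ := by
  have h := abs_lt.1 (abs_sqrt_mul_cos_lt h0 h1 ψ)
  have hd := ((((Real.hasDerivAt_arcsin h.1.ne' h.2.ne).comp ψ
    ((Real.hasDerivAt_cos ψ).const_mul (Real.sqrt ((1 + k) / 2)))).const_mul 2).const_sub
      (Real.pi / 2))
  refine hd.congr_deriv ?_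
  have hr := radicand_pos h0 h1 ψ
  have e : 1 - (Real.sqrt ((1 + k) / 2) * Real.cos ψ) ^ 2 =
      (2 - (1 + k) * Real.cos ψ ^ 2) / 2 := by
    rw [mul_pow, Real.sq_sqrt (by linarith)]
    ring
  rw [e, density, Real.sqrt_div' _ two_pos.le, Real.sqrt_div' _ two_pos.le]
  have h2 : Real.sqrt 2 ≠ 0 := by positivity
  have h3 : Real.sqrt (2 - (1 + k) * Real.cos ψ ^ 2) ≠ 0 := (Real.sqrt_pos.2 hr).ne'
  field_simp

theorem angle_zero {k : ℝ} (h0 : 0 ≤ k) (h1 : k < 1) : angle k 0 = -Real.arcsin k := by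
  have hs := sin_angle (by linarith) h1 0
  have e : sinAngle k 0 = -k := by simp [sinAngle]
  rw [e] at hs
  rw [← Real.arcsin_neg, ← hs, Real.arcsin_sin]
  · have := Real.arcsin_le_pi_div_two (Real.sqrt ((1 + k) / 2) * Real.cos 0)
    unfold angle
    linarith
  · have : 0 ≤ Real.arcsin (Real.sqrt ((1 + k) / 2) * Real.cos 0) := by
      rw [Real.arcsin_nonneg, Real.cos_zero, mul_one]
      exact Real.sqrt_nonneg _
    unfold angle
    linarith

theorem angle_pi_div_two (k : ℝ) : angle k (Real.pi / 2) = Real.pi / 2 := by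
  simp [angle]

/-- The value of the uniformizing variable at which the angle is `0`. -/
def crossing (k : ℝ) : ℝ := Real.arccos (1 / Real.sqrt (1 + k))

theorem crossing_nonneg (k : ℝ) : 0 ≤ crossing k := Real.arccos_nonneg _

theorem crossing_le (k : ℝ) : crossing k ≤ Real.pi / 2 :=
  Real.arccos_le_pi_div_two.2 (by positivity)

theorem cos_crossing {k : ℝ} (h0 : 0 ≤ k) : Real.cos (crossing k) = 1 / Real.sqrt (1 + k) := by
  have h : 1 ≤ Real.sqrt (1 + k) := Real.one_le_sqrt.2 (by linarith)
  have hp : 0 < Real.sqrt (1 + k) := by linarith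
  refine Real.cos_arccos (by linarith [div_pos one_pos hp]) ?_
  rw [div_le_one hp]
  exact h

theorem angle_crossing {k : ℝ} (h0 : 0 ≤ k) : angle k (crossing k) = 0 := by
  unfold angle
  rw [cos_crossing h0, Real.sqrt_div' _ two_pos.le]
  have hp : Real.sqrt (1 + k) ≠ 0 := (Real.sqrt_pos.2 (by linarith)).ne'
  have : Real.sqrt (1 + k) / Real.sqrt 2 * (1 / Real.sqrt (1 + k)) = Real.sin (Real.pi / 4) := by
    rw [Real.sin_pi_div_four]
    field_simp
    rw [Real.sq_sqrt two_pos.le]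
  rw [this, Real.arcsin_sin] <;> linarith [Real.pi_pos]

/-- The factor `√(1 + k) sin ψ` of the derivative of the angle cancels `√(k + sin x)`, so the
singular integrand becomes smooth. -/
theorem deriv_smul_integrand {k y : ℝ} (h0 : 0 ≤ k) (h1 : k < 1) (hy0 : 0 ≤ y)
    (hy1 : y ≤ Real.pi / 2) (f : ℝ → ℝ) {ψ : ℝ} (hψ : ψ ∈ Set.Ioo 0 y) :
    (Real.sqrt (1 + k) * Real.sin ψ * density k ψ) •
      (f (Real.sin (angle k ψ)) / Real.sqrt (k + Real.sin (angle k ψ))) =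
    f (sinAngle k ψ) * density k ψ := by
  have hs : 0 < Real.sin ψ := Real.sin_pos_of_pos_of_lt_pi hψ.1 (by linarith [hψ.2, Real.pi_pos])
  have hk : 0 < Real.sqrt (1 + k) := Real.sqrt_pos.2 (by linarith)
  rw [sin_angle (by linarith) h1, add_sinAngle, Real.sqrt_mul (by linarith), Real.sqrt_sq hs.le,
    smul_eq_mul]
  field_simp

theorem deriv_angle_nonneg {k y : ℝ} (h0 : 0 ≤ k) (h1 : k < 1) (hy0 : 0 ≤ y)
    (hy1 : y ≤ Real.pi / 2) {ψ : ℝ} (hψ : ψ ∈ Set.Ioo 0 y) :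
    0 ≤ Real.sqrt (1 + k) * Real.sin ψ * density k ψ :=
  mul_nonneg (mul_nonneg (Real.sqrt_nonneg _) (Real.sin_pos_of_pos_of_lt_pi hψ.1
    (by linarith [hψ.2, Real.pi_pos])).le) (density_pos (by linarith) h1 ψ).le

theorem continuousOn_angle {k : ℝ} (h0 : -1 ≤ k) (h1 : k < 1) (s : Set ℝ) :
    ContinuousOn (angle k) s := fun ψ _ =>
  (hasDerivAt_angle h0 h1 ψ).continuousAt.continuousWithinAt

theorem arcsin_le_angle {k y : ℝ} (h0 : 0 ≤ k) (h1 : k < 1) (hy0 : 0 ≤ y)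
    (hy1 : y ≤ Real.pi / 2) : -Real.arcsin k ≤ angle k y := by
  rw [← angle_zero h0 h1]
  refine monotoneOn_of_deriv_nonneg (convex_Icc 0 y) (continuousOn_angle (by linarith) h1 _)
    (fun ψ _ => (hasDerivAt_angle (by linarith) h1 ψ).differentiableAt.differentiableWithinAt)
    (fun ψ hψ => ?_) (Set.left_mem_Icc.2 hy0) (Set.right_mem_Icc.2 hy0) hy0
  rw [interior_Icc] at hψ
  rw [(hasDerivAt_angle (by linarith) h1 ψ).deriv]
  exact deriv_angle_nonneg h0 h1 hy0 hy1 hψ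

theorem intervalIntegrable_div_sqrt {k y : ℝ} (h0 : 0 ≤ k) (h1 : k < 1) (hy0 : 0 ≤ y)
    (hy1 : y ≤ Real.pi / 2) {f : ℝ → ℝ} (hf : Continuous f) :
    IntervalIntegrable (fun x => f (Real.sin x) / Real.sqrt (k + Real.sin x)) volume
      (-Real.arcsin k) (angle k y) := by
  rw [intervalIntegrable_iff_integrableOn_Icc_of_le (arcsin_le_angle h0 h1 hy0 hy1),
    ← angle_zero h0 h1,
    ← integrableOn_Icc_deriv_smul_iff_of_deriv_nonneg (continuousOn_angle (by linarith) h1 _)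
      (fun ψ _ => hasDerivAt_angle (by linarith) h1 ψ)
      (fun ψ hψ => deriv_angle_nonneg h0 h1 hy0 hy1 hψ) hy0,
    integrableOn_Icc_iff_integrableOn_Ioo,
    integrableOn_congr_fun (fun ψ hψ => deriv_smul_integrand h0 h1 hy0 hy1 f hψ)
      measurableSet_Ioo, ← integrableOn_Icc_iff_integrableOn_Ioo]
  exact ((hf.comp (continuous_sinAngle k)).mul
    (continuous_density (by linarith) h1)).continuousOn.integrableOn_Icc

theorem integral_div_sqrt {k y : ℝ} (h0 : 0 ≤ k) (h1 : k < 1) (hy0 : 0 ≤ y)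
    (hy1 : y ≤ Real.pi / 2) (f : ℝ → ℝ) :
    ∫ x in (-Real.arcsin k)..(angle k y), f (Real.sin x) / Real.sqrt (k + Real.sin x) =
      ∫ ψ in (0 : ℝ)..y, f (sinAngle k ψ) * density k ψ := by
  rw [← angle_zero h0 h1,
    intervalIntegral.integral_of_le (by
      rw [angle_zero h0 h1]
      exact arcsin_le_angle h0 h1 hy0 hy1), ← integral_Icc_eq_integral_Ioc,
    ← integral_Icc_deriv_smul_of_deriv_nonneg (continuousOn_angle (by linarith) h1 _)
      (fun ψ _ => hasDerivAt_angle (by linarith) h1 ψ)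
      (fun ψ hψ => deriv_angle_nonneg h0 h1 hy0 hy1 hψ) hy0,
    intervalIntegral.integral_of_le hy0,
    integral_Icc_eq_integral_Ioo, integral_Ioc_eq_integral_Ioo]
  exact setIntegral_congr_fun measurableSet_Ioo fun ψ hψ =>
    deriv_smul_integrand h0 h1 hy0 hy1 f hψ

/-- Half the time of travel, in normalized units, between the two turning points. -/
def swing (k : ℝ) : ℝ := ∫ ψ in (0 : ℝ)..(Real.pi / 2), density k ψ

/-- The integral of the sine along half of the motion between the two turning points. -/
def swingMoment (k : ℝ) : ℝ := ∫ ψ in (0 : ℝ)..(Real.pi / 2), sinAngle k ψ * density k ψ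

theorem intervalIntegrable_swing {k : ℝ} (h0 : 0 ≤ k) (h1 : k < 1) {f : ℝ → ℝ}
    (hf : Continuous f) :
    IntervalIntegrable (fun x => f (Real.sin x) / Real.sqrt (k + Real.sin x)) volume
      (-Real.arcsin k) (Real.pi / 2) := by
  simpa only [angle_pi_div_two] using
    intervalIntegrable_div_sqrt h0 h1 Real.pi_div_two_pos.le le_rfl hf

theorem intervalIntegrable_left {k : ℝ} (h0 : 0 ≤ k) (h1 : k < 1) {f : ℝ → ℝ}
    (hf : Continuous f) :
    IntervalIntegrable (fun x => f (Real.sin x) / Real.sqrt (k + Real.sin x)) volume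
      (-Real.arcsin k) 0 := by
  simpa only [angle_crossing h0] using
    intervalIntegrable_div_sqrt h0 h1 (crossing_nonneg k) (crossing_le k) hf

theorem intervalIntegrable_right {k : ℝ} (h0 : 0 ≤ k) {f : ℝ → ℝ} (hf : Continuous f) :
    IntervalIntegrable (fun x => f (Real.sin x) / Real.sqrt (k + Real.sin x)) volume
      0 (Real.pi / 2) := by
  rcases h0.eq_or_lt with rfl | h
  · simpa only [angle_pi_div_two, Real.arcsin_zero, neg_zero] using
      intervalIntegrable_div_sqrt le_rfl one_pos Real.pi_div_two_pos.le le_rfl hf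
  · refine ContinuousOn.intervalIntegrable ?_
    refine (hf.comp Real.continuous_sin).continuousOn.div (by fun_prop) fun x hx => ?_
    rw [Set.uIcc_of_le Real.pi_div_two_pos.le] at hx
    have := Real.sin_nonneg_of_nonneg_of_le_pi hx.1 (by linarith [hx.2, Real.pi_pos])
    exact (Real.sqrt_pos.2 (by linarith)).ne'

theorem integral_left_add_right {k : ℝ} (h0 : 0 ≤ k) (h1 : k < 1) {f : ℝ → ℝ}
    (hf : Continuous f) :
    (∫ x in (-Real.arcsin k)..0, f (Real.sin x) / Real.sqrt (k + Real.sin x)) +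
      (∫ x in (0 : ℝ)..(Real.pi / 2), f (Real.sin x) / Real.sqrt (k + Real.sin x)) =
    ∫ ψ in (0 : ℝ)..(Real.pi / 2), f (sinAngle k ψ) * density k ψ := by
  rw [intervalIntegral.integral_add_adjacent_intervals (intervalIntegrable_left h0 h1 hf)
    (intervalIntegrable_right h0 hf)]
  simpa only [angle_pi_div_two] using
    integral_div_sqrt h0 h1 Real.pi_div_two_pos.le le_rfl f

theorem I₁_eq {k : ℝ} (h0 : 0 ≤ k) (h1 : k < 1) : I₁ k = 2 * swing k - I k := by
  have := integral_left_add_right h0 h1 (f := fun _ => 1) continuous_const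
  simp only [one_mul] at this
  unfold I₁ I swing
  linarith

theorem J₁_eq {k : ℝ} (h0 : 0 ≤ k) (h1 : k < 1) : J₁ k = 2 * swingMoment k - J k := by
  have := integral_left_add_right h0 h1 (f := fun s => s) continuous_id
  unfold J₁ J swingMoment
  linarith

/-- This form matches the motion in `ψ`, which runs from `-crossing k` to `π + crossing k`. -/
theorem I₁_eq_crossing {k : ℝ} (h0 : 0 ≤ k) (h1 : k < 1) :
    I₁ k = swing k + ∫ ψ in (0 : ℝ)..crossing k, density k ψ := by
  have h := integral_left_add_right h0 h1 (f := fun _ => 1) continuous_const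
  have h' := integral_div_sqrt h0 h1 (crossing_nonneg k) (crossing_le k) (fun _ => 1)
  rw [angle_crossing h0] at h'
  simp only [one_mul] at h h'
  unfold I₁ I swing
  linarith

theorem J₁_eq_crossing {k : ℝ} (h0 : 0 ≤ k) (h1 : k < 1) :
    J₁ k = swingMoment k + ∫ ψ in (0 : ℝ)..crossing k, sinAngle k ψ * density k ψ := by
  have h := integral_left_add_right h0 h1 (f := fun s => s) continuous_id
  have h' := integral_div_sqrt h0 h1 (crossing_nonneg k) (crossing_le k) (fun s => s)
  rw [angle_crossing h0] at h'
  unfold J₁ J swingMoment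
  linarith

theorem I₁_zero : I₁ 0 = I 0 := by simp [I₁]

theorem J₁_zero : J₁ 0 = J 0 := by simp [J₁]

theorem swing_zero : swing 0 = I 0 := by
  have := I₁_eq le_rfl one_pos
  rw [I₁_zero] at this
  linarith

/-! ### Monotonicity, continuity and bounds in `k`. -/

theorem density_mono {k k' : ℝ} (h0 : -1 ≤ k) (h : k ≤ k') (h1 : k' < 1) (ψ : ℝ) :
    density k ψ ≤ density k' ψ := by
  unfold density
  refine div_le_div_of_nonneg_left two_pos.le
    (Real.sqrt_pos.2 (radicand_pos (by linarith) h1 ψ)) (Real.sqrt_le_sqrt ?_)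
  nlinarith [sq_nonneg (Real.cos ψ)]

theorem swing_mono {k k' : ℝ} (h0 : 0 ≤ k) (h : k ≤ k') (h1 : k' < 1) : swing k ≤ swing k' :=
  intervalIntegral.integral_mono_on Real.pi_div_two_pos.le
    ((continuous_density (by linarith) (by linarith)).intervalIntegrable _ _)
    ((continuous_density (by linarith) h1).intervalIntegrable _ _)
    fun ψ _ => density_mono (by linarith) h h1 ψ

theorem continuousOn_integral_density (f : ℝ → ℝ) (hf : Continuous f) {K : ℝ} (hK : K < 1) :
    ContinuousOn (fun k => ∫ ψ in (0 : ℝ)..(Real.pi / 2), f (sinAngle k ψ) * density k ψ)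
      (Set.Icc 0 K) := by
  -- Bounding the radicand below by `1 - K` changes nothing for `k` in `[0, K]` and makes the
  -- integrand jointly continuous for all real `k`.
  have hc : Continuous fun k => ∫ ψ in (0 : ℝ)..(Real.pi / 2),
      f (sinAngle k ψ) * (2 / Real.sqrt (max (1 - K) (2 - (1 + k) * Real.cos ψ ^ 2))) := by
    refine intervalIntegral.continuous_parametric_intervalIntegral_of_continuous' ?_ _ _
    refine Continuous.mul (hf.comp ?_) (continuous_const.div ?_ fun p => ?_)
    · unfold sinAngle
      fun_prop
    · fun_prop
    · exact (Real.sqrt_pos.2 (lt_max_of_lt_left (by linarith))).ne'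
  refine hc.continuousOn.congr fun k hk => intervalIntegral.integral_congr fun ψ _ => ?_
  have : 1 - K ≤ 2 - (1 + k) * Real.cos ψ ^ 2 := by
    nlinarith [Real.cos_sq_le_one ψ, sq_nonneg (Real.cos ψ), hk.1, hk.2]
  simp only [density, max_eq_right this]

theorem continuousOn_swing {K : ℝ} (hK : K < 1) : ContinuousOn swing (Set.Icc 0 K) := by
  have := continuousOn_integral_density (fun _ => 1) continuous_const hK
  simp only [one_mul] at this
  exact this

theorem continuousOn_swingMoment {K : ℝ} (hK : K < 1) :
    ContinuousOn swingMoment (Set.Icc 0 K) :=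
  continuousOn_integral_density (fun s => s) continuous_id hK

theorem sin_pos_of_mem {x : ℝ} (hx : x ∈ Set.Ioc 0 (Real.pi / 2)) : 0 < Real.sin x :=
  Real.sin_pos_of_pos_of_lt_pi hx.1 (by linarith [hx.2, Real.pi_pos])

theorem continuousOn_integral_right (f : ℝ → ℝ) (hf : Continuous f) :
    ContinuousOn (fun k => ∫ x in (0 : ℝ)..(Real.pi / 2),
      f (Real.sin x) / Real.sqrt (k + Real.sin x)) (Set.Ici 0) := by
  intro k hk
  refine intervalIntegral.continuousWithinAt_of_dominated_interval
    (bound := fun x => |f (Real.sin x)| / Real.sqrt (0 + Real.sin x)) ?_ ?_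
    (intervalIntegrable_right le_rfl hf.abs) ?_
  · refine Filter.Eventually.of_forall fun k => Measurable.aestronglyMeasurable ?_
    exact (hf.comp Real.continuous_sin).measurable.div (by fun_prop)
  · filter_upwards [self_mem_nhdsWithin] with k hk
    refine Filter.Eventually.of_forall fun x hx => ?_
    rw [Set.uIoc_of_le Real.pi_div_two_pos.le] at hx
    have hs := sin_pos_of_mem hx
    rw [Real.norm_eq_abs, abs_div, abs_of_nonneg (Real.sqrt_nonneg _)]
    exact div_le_div_of_nonneg_left (abs_nonneg _) (Real.sqrt_pos.2 (by linarith))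
      (Real.sqrt_le_sqrt (by linarith [Set.mem_Ici.1 hk]))
  · refine Filter.Eventually.of_forall fun x hx => ContinuousAt.continuousWithinAt ?_
    rw [Set.uIoc_of_le Real.pi_div_two_pos.le] at hx
    have hs := sin_pos_of_mem hx
    refine ContinuousAt.div (by fun_prop) (by fun_prop) ?_
    exact (Real.sqrt_pos.2 (by linarith [Set.mem_Ici.1 hk])).ne'

theorem continuousOn_I : ContinuousOn I (Set.Ici 0) :=
  continuousOn_integral_right (fun _ => 1) continuous_const

theorem continuousOn_J : ContinuousOn J (Set.Ici 0) :=
  continuousOn_integral_right (fun s => s) continuous_id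

theorem intervalIntegrable_I {k : ℝ} (h0 : 0 ≤ k) :
    IntervalIntegrable (fun x => 1 / Real.sqrt (k + Real.sin x)) volume 0 (Real.pi / 2) :=
  intervalIntegrable_right h0 (f := fun _ => 1) continuous_const

theorem intervalIntegrable_J {k : ℝ} (h0 : 0 ≤ k) :
    IntervalIntegrable (fun x => Real.sin x / Real.sqrt (k + Real.sin x)) volume
      0 (Real.pi / 2) :=
  intervalIntegrable_right h0 (f := fun s => s) continuous_id

theorem sqrt_add_sin_pos {k x : ℝ} (h0 : 0 ≤ k) (hx : x ∈ Set.Ioo 0 (Real.pi / 2)) :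
    0 < Real.sqrt (k + Real.sin x) :=
  Real.sqrt_pos.2 (by linarith [sin_pos_of_mem ⟨hx.1, hx.2.le⟩])

theorem I_pos {k : ℝ} (h0 : 0 ≤ k) : 0 < I k :=
  intervalIntegral.intervalIntegral_pos_of_pos_on (intervalIntegrable_I h0)
    (fun _ hx => one_div_pos.2 (sqrt_add_sin_pos h0 hx)) Real.pi_div_two_pos

theorem J_pos {k : ℝ} (h0 : 0 ≤ k) : 0 < J k :=
  intervalIntegral.intervalIntegral_pos_of_pos_on (intervalIntegrable_J h0)
    (fun _ hx => div_pos (sin_pos_of_mem ⟨hx.1, hx.2.le⟩) (sqrt_add_sin_pos h0 hx))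
    Real.pi_div_two_pos

theorem J_le {k : ℝ} (h0 : 0 ≤ k) : J k ≤ J 0 :=
  intervalIntegral.integral_mono_on_of_le_Ioo Real.pi_div_two_pos.le (intervalIntegrable_J h0)
    (intervalIntegrable_J le_rfl) fun x hx =>
      div_le_div_of_nonneg_left (sin_pos_of_mem ⟨hx.1, hx.2.le⟩).le (sqrt_add_sin_pos le_rfl hx)
        (Real.sqrt_le_sqrt (by linarith))

/-- Since `sin x ≤ 1`, one has `(1 + k) sin x ≤ k + sin x`. `cost_family_le` needs exactly this rate
of decay. -/
theorem I_le {k : ℝ} (h0 : 0 ≤ k) : I k ≤ I 0 / Real.sqrt (1 + k) := by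
  have hk : 0 < Real.sqrt (1 + k) := Real.sqrt_pos.2 (by linarith)
  unfold I
  rw [← intervalIntegral.integral_div]
  refine intervalIntegral.integral_mono_on_of_le_Ioo Real.pi_div_two_pos.le
    (intervalIntegrable_I h0) ((intervalIntegrable_I le_rfl).div_const _) fun x hx => ?_
  rw [div_div, ← Real.sqrt_mul (by linarith [sin_pos_of_mem ⟨hx.1, hx.2.le⟩])]
  refine one_div_le_one_div_of_le (Real.sqrt_pos.2 ?_) (Real.sqrt_le_sqrt ?_)
  · have := sin_pos_of_mem ⟨hx.1, hx.2.le⟩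
    positivity
  · nlinarith [Real.sin_le_one x]

theorem I_le_zero {k : ℝ} (h0 : 0 ≤ k) : I k ≤ I 0 :=
  (I_le h0).trans (div_le_self (I_pos le_rfl).le (Real.one_le_sqrt.2 (by linarith)))

/-- In `I₁ = 2 swing - I` the first term is least at `k = 0` and `I` is greatest there, while `swing
0 = I 0`. -/
theorem I_zero_le_I₁ {k : ℝ} (h0 : 0 ≤ k) (h1 : k < 1) : I 0 ≤ I₁ k := by
  rw [I₁_eq h0 h1]
  linarith [swing_mono le_rfl h0 h1, swing_zero, I_le_zero h0]

theorem I₁_pos {k : ℝ} (h0 : 0 ≤ k) (h1 : k < 1) : 0 < I₁ k :=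
  (I_pos le_rfl).trans_le (I_zero_le_I₁ h0 h1)

theorem J₁_le {k : ℝ} (h0 : 0 ≤ k) (h1 : k < 1) : J₁ k ≤ J 0 := by
  have h : ∫ x in (-Real.arcsin k)..0, Real.sin x / Real.sqrt (k + Real.sin x) ≤
      ∫ x in (-Real.arcsin k)..0, (0 : ℝ) := by
    refine intervalIntegral.integral_mono_on (by linarith [Real.arcsin_nonneg.2 h0])
      (intervalIntegrable_left h0 h1 (f := fun s => s) continuous_id) (by simp) fun x hx => ?_
    refine div_nonpos_of_nonpos_of_nonneg (Real.sin_nonpos_of_nonpos_of_neg_pi_le hx.2 ?_)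
      (Real.sqrt_nonneg _)
    linarith [hx.1, Real.arcsin_le_pi_div_two k, Real.pi_pos]
  rw [intervalIntegral.integral_zero] at h
  unfold J₁
  linarith [J_le h0]

/-! ### Solving the consistency equations for `k`. -/

/-- The divergence as `k → 1` is logarithmic. For `k = 1 - ε²` the radicand is `2 sin² ψ + ε² cos² ψ
≤ (ε + 2ψ)²`, so `swing k` is at least the integral of `2/(ε + 2ψ)`, which exceeds `-log ε = |C| +
1`. -/
theorem exists_le_swing (C : ℝ) : ∃ k : ℝ, 0 < k ∧ k < 1 ∧ C ≤ swing k := by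
  set ε := Real.exp (-(|C| + 1)) with hε
  have hε0 : 0 < ε := Real.exp_pos _
  have hε1 : ε < 1 := Real.exp_lt_one_iff.2 (by linarith [abs_nonneg C])
  have hk0 : 0 < 1 - ε ^ 2 := by nlinarith
  have hk1 : 1 - ε ^ 2 < 1 := by nlinarith
  refine ⟨1 - ε ^ 2, hk0, hk1, ?_⟩
  have hpos : ∀ ψ ∈ Set.uIcc 0 (Real.pi / 2), 0 < ε + 2 * ψ := fun ψ hψ => by
    rw [Set.uIcc_of_le Real.pi_div_two_pos.le] at hψ
    linarith [hψ.1]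
  have hF : ∫ ψ in (0 : ℝ)..(Real.pi / 2), 2 / (ε + 2 * ψ) =
      Real.log (ε + 2 * (Real.pi / 2)) - Real.log (ε + 2 * 0) := by
    refine intervalIntegral.integral_eq_sub_of_hasDerivAt (f := fun ψ => Real.log (ε + 2 * ψ))
      (fun ψ hψ => ?_) (ContinuousOn.intervalIntegrable ?_)
    · have := (((hasDerivAt_id ψ).const_mul 2).const_add ε).log (hpos ψ hψ).ne'
      simpa using this
    · exact continuousOn_const.div (by fun_prop) fun ψ hψ => (hpos ψ hψ).ne'
  have hle : ∫ ψ in (0 : ℝ)..(Real.pi / 2), 2 / (ε + 2 * ψ) ≤ swing (1 - ε ^ 2) := by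
    refine intervalIntegral.integral_mono_on Real.pi_div_two_pos.le
      (ContinuousOn.intervalIntegrable ?_)
      ((continuous_density (by linarith) hk1).intervalIntegrable _ _) fun ψ hψ => ?_
    · exact continuousOn_const.div (by fun_prop) fun ψ hψ => (hpos ψ hψ).ne'
    · have hp := radicand_pos (by linarith) hk1 ψ
      refine div_le_div_of_nonneg_left two_pos.le (Real.sqrt_pos.2 hp)
        (Real.sqrt_le_iff.2 ⟨by linarith [hψ.1], ?_⟩)
      have hs := Real.sin_le hψ.1
      have hs0 := Real.sin_nonneg_of_nonneg_of_le_pi hψ.1 (by linarith [hψ.2, Real.pi_pos])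
      nlinarith [Real.sin_sq_add_cos_sq ψ, mul_nonneg hε0.le hψ.1, sq_nonneg (ε * Real.sin ψ),
        sq_nonneg ψ, mul_self_le_mul_self hs0 hs]
  have hlog : Real.log (ε + 2 * 0) = -(|C| + 1) := by rw [mul_zero, add_zero, hε, Real.log_exp]
  have hlog' : 0 ≤ Real.log (ε + 2 * (Real.pi / 2)) :=
    Real.log_nonneg (by linarith [Real.pi_gt_three])
  rw [hF, hlog] at hle
  linarith [le_abs_self C]

/-- Intermediate values of `I₁³ - 2γ J₁`: it is negative at `0` because `γ > γc`, and nonnegative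
near `1` because `J₁` is bounded above while `I₁` is not. -/
theorem exists_I₁_J₁ {γ : ℝ} (h : γc < γ) :
    ∃ k : ℝ, 0 < k ∧ k < 1 ∧ 2 * γ * J₁ k = I₁ k ^ 3 := by
  have hI := I_pos le_rfl
  have hJ := J_pos le_rfl
  have hγ : 0 < γ := lt_of_le_of_lt (by unfold γc; positivity) h
  obtain ⟨K, hK0, hK1, hK⟩ := exists_le_swing (I 0 + 2 * γ * J 0 + 1)
  have hcI : ContinuousOn I₁ (Set.Icc 0 K) := by
    refine ContinuousOn.congr (((continuousOn_swing hK1).const_smul (2 : ℝ)).sub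
      (continuousOn_I.mono fun x hx => hx.1)) fun k hk => ?_
    exact I₁_eq hk.1 (hk.2.trans_lt hK1)
  have hcJ : ContinuousOn J₁ (Set.Icc 0 K) := by
    refine ContinuousOn.congr (((continuousOn_swingMoment hK1).const_smul (2 : ℝ)).sub
      (continuousOn_J.mono fun x hx => hx.1)) fun k hk => ?_
    exact J₁_eq hk.1 (hk.2.trans_lt hK1)
  have hc : ContinuousOn (fun k => I₁ k ^ 3 - 2 * γ * J₁ k) (Set.Icc 0 K) :=
    (hcI.pow 3).sub (continuousOn_const.mul hcJ)
  have h0 : I₁ 0 ^ 3 - 2 * γ * J₁ 0 < 0 := by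
    rw [I₁_zero, J₁_zero]
    unfold γc at h
    rw [div_lt_iff₀ (by positivity)] at h
    linarith
  have hK' : 0 ≤ I₁ K ^ 3 - 2 * γ * J₁ K := by
    have e := I₁_eq hK0.le hK1
    have h2 := I_le_zero hK0.le
    have h3 : 2 * γ * J₁ K ≤ 2 * γ * J 0 :=
      mul_le_mul_of_nonneg_left (J₁_le hK0.le hK1) (by positivity)
    have h4 : 0 < 2 * γ * J 0 := by positivity
    have h5 : 2 * γ * J 0 + 1 ≤ I₁ K := by linarith
    have h6 : I₁ K ≤ I₁ K ^ 3 := le_self_pow₀ (by linarith) (by norm_num)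
    linarith
  obtain ⟨k, hk, hk'⟩ := intermediate_value_Icc hK0.le hc ⟨h0.le, hK'⟩
  simp only at hk'
  refine ⟨k, hk.1.lt_of_ne ?_, hk.2.trans_lt hK1, by linarith⟩
  rintro rfl
  linarith

theorem exists_I_J {γ : ℝ} (h0 : 0 < γ) (h : γ < γc) :
    ∃ k : ℝ, 0 < k ∧ 2 * γ * J k = I k ^ 3 := by
  have hI := I_pos le_rfl
  have hJ := J_pos le_rfl
  -- `K ≥ 1` gives `K + sin x ≤ (9/4) K`, hence a lower bound for `J K`. `γ K ≥ 3` then settles the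
  -- sign at `K`, since `(π/2)³ < 4`.
  set K := 1 + 3 / γ with hKdef
  have hK1 : 1 ≤ K := by
    have : 0 < 3 / γ := by positivity
    linarith
  have hKγ : 3 ≤ γ * K := by
    have : γ * (3 / γ) = 3 := by field_simp
    nlinarith
  have hK0 : 0 < K := by linarith
  have hc : ContinuousOn (fun k => 2 * γ * J k - I k ^ 3) (Set.Icc 0 K) :=
    (continuousOn_const.mul (continuousOn_J.mono fun x hx => hx.1)).sub
      ((continuousOn_I.mono fun x hx => hx.1).pow 3)
  have hz : 2 * γ * J 0 - I 0 ^ 3 < 0 := by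
    unfold γc at h
    rw [lt_div_iff₀ (by positivity)] at h
    linarith
  have hs : 0 < Real.sqrt K := Real.sqrt_pos.2 hK0
  have hs' : Real.sqrt K * Real.sqrt K = K := Real.mul_self_sqrt hK0.le
  have hIK : I K ≤ Real.pi / 2 / Real.sqrt K := by
    have : I K ≤ ∫ x in (0 : ℝ)..(Real.pi / 2), 1 / Real.sqrt K := by
      refine intervalIntegral.integral_mono_on_of_le_Ioo Real.pi_div_two_pos.le
        (intervalIntegrable_I hK0.le) (by simp) fun x hx => ?_
      exact one_div_le_one_div_of_le hs
        (Real.sqrt_le_sqrt (by linarith [sin_pos_of_mem ⟨hx.1, hx.2.le⟩]))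
    simpa [div_eq_mul_inv] using this
  have hJK : 1 / (3 / 2 * Real.sqrt K) ≤ J K := by
    have : ∫ x in (0 : ℝ)..(Real.pi / 2), Real.sin x / (3 / 2 * Real.sqrt K) ≤ J K := by
      refine intervalIntegral.integral_mono_on_of_le_Ioo Real.pi_div_two_pos.le
        (Continuous.intervalIntegrable (by fun_prop) _ _) (intervalIntegrable_J hK0.le)
        fun x hx => ?_
      refine div_le_div_of_nonneg_left (sin_pos_of_mem ⟨hx.1, hx.2.le⟩).le
        (sqrt_add_sin_pos hK0.le hx) (Real.sqrt_le_iff.2 ⟨by positivity, ?_⟩)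
      nlinarith [Real.sin_le_one x]
    rw [intervalIntegral.integral_div, integral_sin] at this
    simpa using this
  have hend : 0 ≤ 2 * γ * J K - I K ^ 3 := by
    have h1 : I K ^ 3 ≤ (Real.pi / 2 / Real.sqrt K) ^ 3 :=
      pow_le_pow_left₀ (I_pos hK0.le).le hIK 3
    have h2 : 2 * γ * (1 / (3 / 2 * Real.sqrt K)) ≤ 2 * γ * J K :=
      mul_le_mul_of_nonneg_left hJK (by positivity)
    have h3 : (Real.pi / 2 / Real.sqrt K) ^ 3 = (Real.pi / 2) ^ 3 / K / Real.sqrt K := by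
      rw [div_pow, div_div]
      congr 1
      rw [← hs']
      ring_nf
      rw [Real.sq_sqrt (by positivity)]
      rw [show Real.sqrt K ^ 3 = Real.sqrt K * Real.sqrt K * Real.sqrt K by ring, hs']
    have h4 : 2 * γ * (1 / (3 / 2 * Real.sqrt K)) = (4 / 3 * γ) / Real.sqrt K := by
      field_simp
      ring
    have h5 : (Real.pi / 2) ^ 3 / K ≤ 4 / 3 * γ := by
      rw [div_le_iff₀ hK0]
      have hp : Real.pi / 2 ≤ 1.58 := by linarith [Real.pi_lt_d2]
      have := pow_le_pow_left₀ Real.pi_div_two_pos.le hp 3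
      nlinarith
    have h6 := div_le_div_of_nonneg_right h5 hs.le
    linarith
  obtain ⟨k, hk, hk'⟩ := intermediate_value_Icc hK0.le hc ⟨hz.le, hend⟩
  simp only at hk'
  refine ⟨k, hk.1.lt_of_ne ?_, by linarith⟩
  rintro rfl
  linarith

/-! ### Convexity of `k I₁ + J₁`. -/

/-- For negative `x` both sides are `0`: on the right through the factor `cos (π/2)` in the real
power of a negative base. -/
theorem inv_sqrt_eq_rpow (x : ℝ) : 1 / Real.sqrt x = x ^ (-(1 / 2) : ℝ) := by
  rcases le_or_gt 0 x with hx | hx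
  · rw [Real.rpow_neg hx, Real.sqrt_eq_rpow, one_div]
  · rw [Real.sqrt_eq_zero_of_nonpos hx.le, Real.rpow_def_of_neg hx,
      show (-(1 / 2) : ℝ) * Real.pi = -(Real.pi / 2) by ring, Real.cos_neg, Real.cos_pi_div_two]
    simp

theorem intervalIntegrable_inv_sqrt (s a b : ℝ) :
    IntervalIntegrable (fun κ => 1 / Real.sqrt (κ + s)) volume a b := by
  simp only [inv_sqrt_eq_rpow]
  have := (intervalIntegral.intervalIntegrable_rpow' (a := a + s) (b := b + s)
    (r := -(1 / 2)) (by norm_num)).comp_add_right s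
  simpa using this

theorem integral_inv_sqrt (s a b : ℝ) :
    ∫ κ in a..b, 1 / Real.sqrt (κ + s) = 2 * Real.sqrt (b + s) - 2 * Real.sqrt (a + s) := by
  refine integral_eq_of_hasDerivAt_off_countable
    (fun κ => 2 * Real.sqrt (κ + s)) _ (s := {-s}) (Set.countable_singleton _) (by fun_prop)
    (fun κ hκ => ?_) (intervalIntegrable_inv_sqrt s a b)
  have hne : κ + s ≠ 0 := fun h => hκ.2 (by simp; linarith)
  have := ((((hasDerivAt_id κ).add_const s).sqrt hne)).const_mul 2
  refine this.congr_deriv ?_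
  simp only [id]
  ring

/-- With `√y = 0` for `y ≤ 0` and `1/0 = 0`, the integrands vanish to the left of `-arcsin k`. The
interval of integration then no longer depends on `k`, as Fubini requires. -/
theorem extend_left {k : ℝ} (h0 : 0 ≤ k) (h1 : k < 1) {f : ℝ → ℝ}
    (hf : ∀ x, k + Real.sin x ≤ 0 → f x = 0)
    (hi : IntervalIntegrable f volume (-Real.arcsin k) (Real.pi / 2)) :
    IntervalIntegrable f volume (-(Real.pi / 2)) (Real.pi / 2) ∧
      ∫ x in (-(Real.pi / 2))..(Real.pi / 2), f x =
        ∫ x in (-Real.arcsin k)..(Real.pi / 2), f x := by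
  have hle : -(Real.pi / 2) ≤ -Real.arcsin k := neg_le_neg (Real.arcsin_le_pi_div_two k)
  have hz : ∀ x ∈ Set.uIoc (-(Real.pi / 2)) (-Real.arcsin k), f x = 0 := fun x hx => by
    rw [Set.uIoc_of_le hle] at hx
    refine hf x ?_
    have := Real.sin_le_sin_of_le_of_le_pi_div_two hx.1.le
      ((neg_nonpos.2 (Real.arcsin_nonneg.2 h0)).trans Real.pi_div_two_pos.le) hx.2
    rw [Real.sin_neg, Real.sin_arcsin (by linarith) h1.le] at this
    linarith
  have hi' : IntervalIntegrable f volume (-(Real.pi / 2)) (-Real.arcsin k) :=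
    (intervalIntegrable_const (c := (0 : ℝ))).congr fun x hx => (hz x hx).symm
  refine ⟨hi'.trans hi, ?_⟩
  rw [← intervalIntegral.integral_add_adjacent_intervals hi' hi,
    intervalIntegral.integral_zero_ae (Filter.Eventually.of_forall hz), zero_add]

theorem intervalIntegrable_inv_sqrt_sin {k : ℝ} (h0 : 0 ≤ k) (h1 : k < 1) :
    IntervalIntegrable (fun x => 1 / Real.sqrt (k + Real.sin x)) volume
      (-(Real.pi / 2)) (Real.pi / 2) :=
  (extend_left h0 h1 (fun x hx => by rw [Real.sqrt_eq_zero_of_nonpos hx, div_zero])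
    (intervalIntegrable_swing h0 h1 (f := fun _ => 1) continuous_const)).1

theorem integral_inv_sqrt_sin {k : ℝ} (h0 : 0 ≤ k) (h1 : k < 1) :
    ∫ x in (-(Real.pi / 2))..(Real.pi / 2), 1 / Real.sqrt (k + Real.sin x) = swing k := by
  rw [(extend_left h0 h1 (fun x hx => by rw [Real.sqrt_eq_zero_of_nonpos hx, div_zero])
    (intervalIntegrable_swing h0 h1 (f := fun _ => 1) continuous_const)).2]
  have := integral_div_sqrt h0 h1 Real.pi_div_two_pos.le le_rfl (fun _ => 1)
  simp only [angle_pi_div_two, one_mul] at this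
  exact this

theorem integral_sqrt_sin {k : ℝ} (h0 : 0 ≤ k) (h1 : k < 1) :
    ∫ x in (-(Real.pi / 2))..(Real.pi / 2), Real.sqrt (k + Real.sin x) =
      k * swing k + swingMoment k := by
  rw [(extend_left h0 h1 (fun x hx => Real.sqrt_eq_zero_of_nonpos hx)
    (Continuous.intervalIntegrable (by fun_prop) _ _)).2]
  have := integral_div_sqrt h0 h1 Real.pi_div_two_pos.le le_rfl (fun s => k + s)
  simp only [angle_pi_div_two, Real.div_sqrt, add_mul] at this
  have hd := continuous_density (by linarith) h1
  rw [this, intervalIntegral.integral_add (g := fun ψ => sinAngle k ψ * density k ψ)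
    ((hd.const_mul k).intervalIntegrable _ _)
    (((continuous_sinAngle k).mul hd).intervalIntegrable _ _),
    intervalIntegral.integral_const_mul]
  rfl

theorem integral_sqrt_sin_right {k : ℝ} (h0 : 0 ≤ k) :
    ∫ x in (0 : ℝ)..(Real.pi / 2), Real.sqrt (k + Real.sin x) = k * I k + J k := by
  unfold I J
  rw [← intervalIntegral.integral_const_mul, ← intervalIntegral.integral_add
    ((intervalIntegrable_I h0).const_mul k) (intervalIntegrable_J h0)]
  refine intervalIntegral.integral_congr fun x _ => ?_
  rw [mul_one_div, ← add_div, Real.div_sqrt]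

/-- Interchange the integrals over `κ` and `x`; the inner integral of `1/√(κ + sin x)` in `κ` is
`2√(κ + sin x)` between the endpoints. -/
theorem integral_swing {a b : ℝ} (ha0 : 0 ≤ a) (ha1 : a < 1) (hb0 : 0 ≤ b) (hb1 : b < 1) :
    ∫ κ in a..b, swing κ =
      2 * (b * swing b + swingMoment b) - 2 * (a * swing a + swingMoment a) := by
  have hmem : ∀ κ ∈ Set.uIcc a b, 0 ≤ κ ∧ κ < 1 := fun κ hκ =>
    ⟨(le_min ha0 hb0).trans hκ.1, hκ.2.trans_lt (max_lt ha1 hb1)⟩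
  have hsw : IntervalIntegrable swing volume a b :=
    ((continuousOn_swing (max_lt ha1 hb1)).mono fun κ hκ =>
      ⟨(hmem κ hκ).1, hκ.2⟩).intervalIntegrable
  have hpi : -(Real.pi / 2) ≤ Real.pi / 2 := by linarith [Real.pi_pos]
  have hint : IntegrableOn (Function.uncurry fun κ x => 1 / Real.sqrt (κ + Real.sin x))
      (Set.uIoc a b ×ˢ Set.uIoc (-(Real.pi / 2)) (Real.pi / 2)) := by
    rw [IntegrableOn, Measure.volume_eq_prod, ← Measure.prod_restrict, integrable_prod_iff]
    · constructor
      · refine (ae_restrict_iff' measurableSet_uIoc).2 (Filter.Eventually.of_forall fun κ hκ => ?_)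
        have := hmem κ (Set.uIoc_subset_uIcc hκ)
        exact (intervalIntegrable_inv_sqrt_sin this.1 this.2).def'
      · refine IntegrableOn.congr_fun hsw.def' (fun κ hκ => ?_) measurableSet_uIoc
        have := hmem κ (Set.uIoc_subset_uIcc hκ)
        rw [← integral_inv_sqrt_sin this.1 this.2, intervalIntegral.integral_of_le hpi,
          Set.uIoc_of_le hpi]
        refine integral_congr_ae (Filter.Eventually.of_forall fun x => ?_)
        simp only [Function.uncurry]
        rw [Real.norm_of_nonneg (by positivity)]
    · refine Measurable.aestronglyMeasurable ?_
      unfold Function.uncurry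
      fun_prop
  have hswap := intervalIntegral_intervalIntegral_swap hint
  simp only [integral_inv_sqrt] at hswap
  rw [intervalIntegral.integral_congr fun κ hκ =>
    (integral_inv_sqrt_sin (hmem κ hκ).1 (hmem κ hκ).2).symm, hswap,
    intervalIntegral.integral_sub (Continuous.intervalIntegrable (by fun_prop) _ _)
      (Continuous.intervalIntegrable (by fun_prop) _ _),
    intervalIntegral.integral_const_mul, intervalIntegral.integral_const_mul,
    integral_sqrt_sin ha0 ha1, integral_sqrt_sin hb0 hb1]

/-- Convexity: by `integral_swing` the function has derivative `swing/2`, which is monotone. -/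
theorem swing_tangent {a b : ℝ} (ha0 : 0 ≤ a) (ha1 : a < 1) (hb0 : 0 ≤ b) (hb1 : b < 1) :
    a * swing a + swingMoment a + swing a / 2 * (b - a) ≤ b * swing b + swingMoment b := by
  have key : swing a * (b - a) ≤ ∫ κ in a..b, swing κ := by
    have hc : ∀ {s t : ℝ}, 0 ≤ s → t < 1 → s ≤ t → IntervalIntegrable swing volume s t :=
      fun hs ht hst => ((continuousOn_swing ht).mono (by
        rw [Set.uIcc_of_le hst]
        exact Set.Icc_subset_Icc_left hs)).intervalIntegrable
    rcases le_total a b with h | h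
    · have := intervalIntegral.integral_mono_on h intervalIntegrable_const (hc ha0 hb1 h)
        fun κ hκ => swing_mono ha0 hκ.1 (hκ.2.trans_lt hb1)
      rw [intervalIntegral.integral_const, smul_eq_mul] at this
      linarith
    · have := intervalIntegral.integral_mono_on h (hc hb0 ha1 h) intervalIntegrable_const
        fun κ hκ => swing_mono (hb0.trans hκ.1) hκ.2 ha1
      rw [intervalIntegral.integral_const, smul_eq_mul] at this
      rw [intervalIntegral.integral_symm]
      linarith
  rw [integral_swing ha0 ha1 hb0 hb1] at key
  linarith

/-- Concavity of the square root, `√B ≤ √A + (B - A)/(2√A)`, integrated over `x`. -/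
theorem I_tangent {a b : ℝ} (ha : 0 ≤ a) (hb : 0 ≤ b) :
    b * I b + J b ≤ a * I a + J a + I a / 2 * (b - a) := by
  rw [← integral_sqrt_sin_right ha, ← integral_sqrt_sin_right hb]
  have : I a / 2 * (b - a) = ∫ x in (0 : ℝ)..(Real.pi / 2),
      (b - a) / 2 * (1 / Real.sqrt (a + Real.sin x)) := by
    rw [intervalIntegral.integral_const_mul]
    unfold I
    ring
  rw [this, ← intervalIntegral.integral_add (Continuous.intervalIntegrable (by fun_prop) _ _)
    ((intervalIntegrable_I ha).const_mul _)]
  refine intervalIntegral.integral_mono_on_of_le_Ioo Real.pi_div_two_pos.le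
    (Continuous.intervalIntegrable (by fun_prop) _ _)
    ((Continuous.intervalIntegrable (by fun_prop) _ _).add
      ((intervalIntegrable_I ha).const_mul _)) fun x hx => ?_
  have hp := sqrt_add_sin_pos ha hx
  have hs := sin_pos_of_mem ⟨hx.1, hx.2.le⟩
  have e1 := Real.sq_sqrt (show 0 ≤ a + Real.sin x by linarith)
  have e2 := Real.sq_sqrt (show 0 ≤ b + Real.sin x by linarith)
  have e3 : b - a = Real.sqrt (b + Real.sin x) ^ 2 - Real.sqrt (a + Real.sin x) ^ 2 := by linarith
  rw [e3, mul_one_div, div_div, ← sub_le_iff_le_add', le_div_iff₀ (by positivity)]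
  nlinarith [sq_nonneg (Real.sqrt (b + Real.sin x) - Real.sqrt (a + Real.sin x))]

/-- The function `k ↦ k I₁ + J₁` is convex with derivative `I₁ / 2`. -/
theorem I₁_tangent {a b : ℝ} (ha0 : 0 ≤ a) (ha1 : a < 1) (hb0 : 0 ≤ b) (hb1 : b < 1) :
    a * I₁ a + J₁ a + I₁ a / 2 * (b - a) ≤ b * I₁ b + J₁ b := by
  -- `k I₁ + J₁` is twice the convex `k swing + swingMoment` minus the concave `k I + J`.
  rw [I₁_eq ha0 ha1, I₁_eq hb0 hb1, J₁_eq ha0 ha1, J₁_eq hb0 hb1]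
  linarith [swing_tangent ha0 ha1 hb0 hb1, I_tangent ha0 hb0]

/-! ### Cost of the extremals without turning points. -/

/-- Integrating the derivative of `cos x √(sin x)` gives `I 0 = 3 ∫ sin² x/√(sin x)`, and `sin² ≤
sin`. -/
theorem I_zero_le_three_mul_J_zero : I 0 ≤ 3 * J 0 := by
  have hi : IntervalIntegrable (fun x => Real.sin x ^ 2 / Real.sqrt (0 + Real.sin x)) volume
      0 (Real.pi / 2) := intervalIntegrable_right le_rfl (f := fun s => s ^ 2) (by fun_prop)
  have hF : ∫ x in (0 : ℝ)..(Real.pi / 2), ((1 / 2) * (1 / Real.sqrt (0 + Real.sin x)) -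
      (3 / 2) * (Real.sin x ^ 2 / Real.sqrt (0 + Real.sin x))) = 0 := by
    rw [intervalIntegral.integral_eq_sub_of_hasDerivAt_of_le Real.pi_div_two_pos.le
      (f := fun x => Real.cos x * Real.sqrt (Real.sin x)) (by fun_prop) (fun x hx => ?_)
      (((intervalIntegrable_I le_rfl).const_mul _).sub (hi.const_mul _))]
    · simp
    · have hs := sin_pos_of_mem ⟨hx.1, hx.2.le⟩
      refine ((Real.hasDerivAt_cos x).mul ((Real.hasDerivAt_sin x).sqrt hs.ne')).congr_deriv ?_
      have hq := Real.sqrt_pos.2 hs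
      rw [zero_add]
      field_simp
      rw [Real.sq_sqrt hs.le, Real.cos_sq']
      ring
  rw [intervalIntegral.integral_sub ((intervalIntegrable_I le_rfl).const_mul _)
    (hi.const_mul _), intervalIntegral.integral_const_mul,
    intervalIntegral.integral_const_mul] at hF
  have hle : ∫ x in (0 : ℝ)..(Real.pi / 2), Real.sin x ^ 2 / Real.sqrt (0 + Real.sin x) ≤ J 0 := by
    refine intervalIntegral.integral_mono_on_of_le_Ioo Real.pi_div_two_pos.le hi
      (intervalIntegrable_J le_rfl) fun x hx => ?_
    have hs := sin_pos_of_mem ⟨hx.1, hx.2.le⟩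
    refine div_le_div_of_nonneg_right ?_ (Real.sqrt_nonneg _)
    nlinarith [Real.sin_le_one x]
  unfold I
  linarith

/-- Reduction to `k = 0`. With `s = sin x`, `s(3k + 1) - (k + s) = k(3s - 1)` has the sign of `3s -
1`, so replacing `√(k + s)` by `√(s(3k + 1))` lowers the integrand of `3J - I` on both sides of `s =
1/3`. -/
theorem I_le_three_mul_J {k : ℝ} (hk : 0 ≤ k) : I k ≤ 3 * J k := by
  have hc : (0 : ℝ) < 3 * k + 1 := by linarith
  set c := 1 / Real.sqrt (3 * k + 1) with hcdef
  have h : c * (3 * J 0 - I 0) ≤ 3 * J k - I k := by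
    unfold I J
    rw [← intervalIntegral.integral_const_mul, ← intervalIntegral.integral_const_mul,
      ← intervalIntegral.integral_sub ((intervalIntegrable_J le_rfl).const_mul 3)
        (intervalIntegrable_I le_rfl),
      ← intervalIntegral.integral_sub ((intervalIntegrable_J hk).const_mul 3)
        (intervalIntegrable_I hk), ← intervalIntegral.integral_const_mul]
    refine intervalIntegral.integral_mono_on_of_le_Ioo Real.pi_div_two_pos.le
      ((((intervalIntegrable_J le_rfl).const_mul 3).sub
        (intervalIntegrable_I le_rfl)).const_mul c)
      (((intervalIntegrable_J hk).const_mul 3).sub (intervalIntegrable_I hk)) fun x hx => ?_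
    have hs := sin_pos_of_mem ⟨hx.1, hx.2.le⟩
    set s := Real.sin x with hsdef
    have hks : 0 < k + s := by linarith
    have e : ∀ d : ℝ, 3 * (s / d) - 1 / d = (3 * s - 1) / d := fun d => by ring
    rw [e, e, zero_add, hcdef, one_div_mul_eq_div, div_div, ← Real.sqrt_mul hs.le]
    rcases le_total 0 (3 * s - 1) with h3 | h3
    · refine div_le_div_of_nonneg_left h3 (Real.sqrt_pos.2 hks) (Real.sqrt_le_sqrt ?_)
      nlinarith
    · rw [div_le_div_iff₀ (Real.sqrt_pos.2 (mul_pos hs hc)) (Real.sqrt_pos.2 hks)]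
      refine mul_le_mul_of_nonpos_left (Real.sqrt_le_sqrt ?_) h3
      nlinarith
  have hc0 : 0 ≤ c := by positivity
  nlinarith [mul_nonneg hc0 (sub_nonneg.2 I_zero_le_three_mul_J_zero)]

/-- The cost along the family without turning points is at most its value at `k = 0`. -/
theorem cost_family_le {γ k : ℝ} (hγ : 0 < γ) (hk : 0 ≤ k) (h : 2 * γ * J k = I k ^ 3) :
    k * I k ^ 2 / 2 + 3 / (8 * γ) * I k ^ 4 ≤ 3 / (8 * γ) * I 0 ^ 4 := by
  have hI := I_pos hk
  have hJ := J_pos hk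
  have h1 : I k * Real.sqrt (1 + k) ≤ I 0 :=
    (le_div_iff₀ (Real.sqrt_pos.2 (by linarith))).1 (I_le hk)
  have h2 : I k ^ 4 * (1 + k) ^ 2 ≤ I 0 ^ 4 := by
    have := pow_le_pow_left₀ (by positivity) h1 4
    rw [mul_pow, show Real.sqrt (1 + k) ^ 4 = (Real.sqrt (1 + k) ^ 2) ^ 2 by ring,
      Real.sq_sqrt (by linarith)] at this
    exact this
  have h3 := I_le_three_mul_J hk
  -- This bounds the kinetic term by `3/(8γ) · 2k I⁴`, and `1 + 2k ≤ (1 + k)²` then reduces the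
  -- claim to `h2`.
  have h4 : 2 * γ ≤ 3 * I k ^ 2 := by
    by_contra hlt
    rw [not_le] at hlt
    nlinarith [mul_lt_mul_of_pos_right hlt hJ, mul_le_mul_of_nonneg_left h3 (sq_nonneg (I k))]
  have h5 : k * I k ^ 2 / 2 = 3 / (8 * γ) * (4 * γ / 3 * k * I k ^ 2) := by
    field_simp
    ring
  rw [h5, ← mul_add]
  refine mul_le_mul_of_nonneg_left (le_trans ?_ h2) (by positivity)
  have h6 : 0 ≤ k * I k ^ 2 := by positivity
  nlinarith [mul_le_mul_of_nonneg_right h4 h6, sq_nonneg (k * I k ^ 2)]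

/-! ### Construction of the simplest extremals. -/

/-- The scalar autonomous equation `y' = g y` with bounded positive velocity. -/
theorem exists_flow {g : ℝ → ℝ} (hg : Continuous g) (hpos : ∀ y, 0 < g y) {M : ℝ}
    (hM : ∀ y, g y ≤ M) (a : ℝ) :
    ∃ y : ℝ → ℝ, (∀ t, HasDerivAt y (g (y t)) t) ∧ ∀ b, y (∫ z in a..b, (g z)⁻¹) = b := by
  have hM0 : 0 < M := (hpos 0).trans_le (hM 0)
  have hc : Continuous fun z => (g z)⁻¹ := hg.inv₀ fun z => (hpos z).ne'
  -- The solution is the inverse of the travel time. The upper bound on the velocity makes `τ`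
  -- unbounded in both directions, hence onto.
  set τ : ℝ → ℝ := fun b => ∫ z in a..b, (g z)⁻¹ with hτ
  have hd : ∀ z, HasDerivAt τ (g z)⁻¹ z := fun z =>
    intervalIntegral.integral_hasDerivAt_right (hc.intervalIntegrable _ _)
      (hc.stronglyMeasurableAtFilter _ _) hc.continuousAt
  have hmono : StrictMono τ := strictMono_of_deriv_pos fun z => by
    rw [(hd z).deriv]
    exact inv_pos.2 (hpos z)
  have hlow : ∀ z w, z ≤ w → M⁻¹ * (w - z) ≤ τ w - τ z := fun z w hzw => by
    refine Convex.mul_sub_le_image_sub_of_le_deriv convex_univ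
      (fun x _ => (hd x).continuousAt.continuousWithinAt)
      (fun x _ => (hd x).differentiableAt.differentiableWithinAt) (fun x _ => ?_)
      z trivial w trivial hzw
    rw [(hd x).deriv]
    exact inv_anti₀ (hpos x) (hM x)
  have hsurj : Function.Surjective τ := by
    refine Continuous.surjective (continuous_iff_continuousAt.2 fun z => (hd z).continuousAt) ?_ ?_
    · refine Filter.tendsto_atTop_mono' _ ?_
        (Filter.Tendsto.const_mul_atTop (inv_pos.2 hM0)
          (Filter.tendsto_atTop_add_const_right Filter.atTop (-a) Filter.tendsto_id))
      filter_upwards [Filter.eventually_ge_atTop a] with z hz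
      have := hlow a z hz
      simp only [hτ, intervalIntegral.integral_same, sub_zero] at this
      simpa [hτ, sub_eq_add_neg] using this
    · refine Filter.tendsto_atBot_mono' _ ?_
        (Filter.Tendsto.const_mul_atBot (inv_pos.2 hM0)
          (Filter.tendsto_atBot_add_const_right Filter.atBot (-a) Filter.tendsto_id))
      filter_upwards [Filter.eventually_le_atBot a] with z hz
      have := hlow z a hz
      simp only [hτ, intervalIntegral.integral_same, zero_sub] at this
      simp only [id, hτ]
      linarith
  let e := (hmono.orderIsoOfSurjective τ hsurj).toHomeomorph
  have he : ∀ z, τ (e.symm z) = z := fun z => e.apply_symm_apply z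
  refine ⟨e.symm, fun t => ?_, fun b => e.symm_apply_apply b⟩
  have := HasDerivAt.of_local_left_inverse e.symm.continuous.continuousAt (hd (e.symm t))
    (inv_pos.2 (hpos _)).ne' (Filter.Eventually.of_forall he)
  rwa [inv_inv] at this

theorem integral_comp_flow {f g y : ℝ → ℝ} (hf : Continuous f) (hg : Continuous g)
    (hpos : ∀ y, 0 < g y) (hy : ∀ t, HasDerivAt y (g (y t)) t) (s t : ℝ) :
    ∫ x in s..t, f (y x) = ∫ z in y s..y t, f z * (g z)⁻¹ := by
  have hyc : Continuous y := continuous_iff_continuousAt.2 fun x => (hy x).continuousAt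
  rw [← intervalIntegral.integral_comp_mul_deriv (g := fun z => f z * (g z)⁻¹) (fun x _ => hy x)
    (hg.comp hyc).continuousOn (hf.mul (hg.inv₀ fun z => (hpos z).ne'))]
  refine intervalIntegral.integral_congr fun x _ => ?_
  have := (hpos (y x)).ne'
  simp only [Function.comp]
  field_simp

theorem hasDerivWithinAt_integral {f : ℝ → ℝ} (hf : ContinuousOn f (Set.Icc 0 1)) (t : ℝ)
    (ht : t ∈ Set.Icc (0 : ℝ) 1) :
    HasDerivWithinAt (fun t => ∫ s in (0 : ℝ)..t, f s) (f t) (Set.Icc 0 1) t := by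
  have : Fact (t ∈ Set.Icc (0 : ℝ) 1) := ⟨ht⟩
  refine intervalIntegral.integral_hasDerivWithinAt_right ?_ ?_ (hf t ht)
  · exact (hf.mono (by
      rw [Set.uIcc_of_le ht.1]
      exact Set.Icc_subset_Icc_right ht.2)).intervalIntegrable
  · exact hf.stronglyMeasurableAtFilter_nhdsWithin measurableSet_Icc t

theorem eq_of_hasDerivWithinAt_zero {f : ℝ → ℝ}
    (hf : ∀ t ∈ Set.Icc (0 : ℝ) 1, HasDerivWithinAt f 0 (Set.Icc 0 1) t) {t : ℝ}
    (ht : t ∈ Set.Icc (0 : ℝ) 1) : f t = f 0 :=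
  constant_of_derivWithin_zero (fun s hs => (hf s hs).differentiableWithinAt)
    (fun s hs => (hf s ⟨hs.1, hs.2.le⟩).derivWithin
      ((uniqueDiffOn_Icc one_pos) s ⟨hs.1, hs.2.le⟩)) t ht

/-- A solution of the pendulum equation that satisfies the boundary and the consistency
conditions is an extremal. -/
theorem exists_isExtremal {γ X : ℝ} {θ u : ℝ → ℝ} (hθ0 : θ 0 = 0) (hθ1 : θ 1 = Real.pi / 2)
    (hθ : ∀ t ∈ Set.Icc (0 : ℝ) 1, HasDerivWithinAt θ (u t) (Set.Icc 0 1) t)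
    (hu : ∀ t ∈ Set.Icc (0 : ℝ) 1,
      HasDerivWithinAt u (2 * γ * X * Real.cos (2 * θ t)) (Set.Icc 0 1) t)
    (hX : ∫ t in (0 : ℝ)..1, Real.sin (2 * θ t) = X)
    (hZ : ∫ t in (0 : ℝ)..1, Real.cos (2 * θ t) = 0) :
    ∃ p : Trajectory, IsExtremal γ p ∧ HasInitialControl p (u 0) ∧ p.Sx 1 = X := by
  have hθc : ContinuousOn θ (Set.Icc 0 1) := fun t ht => (hθ t ht).continuousWithinAt
  have huc : ContinuousOn u (Set.Icc 0 1) := fun t ht => (hu t ht).continuousWithinAt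
  let p : Trajectory :=
    { u := u
      θ := θ
      Sz := fun t => ∫ s in (0 : ℝ)..t, Real.cos (2 * θ s)
      Sx := fun t => ∫ s in (0 : ℝ)..t, Real.sin (2 * θ s) }
  have hSz : ∀ t ∈ Set.Icc (0 : ℝ) 1,
      HasDerivWithinAt p.Sz (Real.cos (2 * θ t)) (Set.Icc 0 1) t :=
    hasDerivWithinAt_integral (f := fun t => Real.cos (2 * θ t)) (by fun_prop)
  have hSx : ∀ t ∈ Set.Icc (0 : ℝ) 1,
      HasDerivWithinAt p.Sx (Real.sin (2 * θ t)) (Set.Icc 0 1) t :=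
    hasDerivWithinAt_integral (f := fun t => Real.sin (2 * θ t)) (by fun_prop)
  have hE : ∀ t ∈ Set.Icc (0 : ℝ) 1, u t ^ 2 / 2 - γ * X * Real.sin (2 * θ t) =
      u 0 ^ 2 / 2 - γ * X * Real.sin (2 * θ 0) := by
    intro t ht
    refine eq_of_hasDerivWithinAt_zero
      (f := fun s => u s ^ 2 / 2 - γ * X * Real.sin (2 * θ s)) (fun s hs => ?_) ht
    refine ((((hu s hs).pow 2).div_const 2).sub
      ((((hθ s hs).const_mul 2).sin).const_mul (γ * X))).congr_deriv ?_
    push_cast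
    ring
  obtain ⟨M, hM⟩ := isCompact_Icc.exists_bound_of_continuousOn huc
  -- Normal multiplier `-1`. Then `lθ = u` by maximality, and the constants in `lz`, `lx` are fixed
  -- by transversality, using `Sz(1) = 0` and `Sx(1) = X`.
  refine ⟨p, ⟨⟨huc.aemeasurable measurableSet_Icc, ⟨M, hM⟩, fun t ht => ?_, fun _ _ => rfl,
    fun _ _ => rfl, hθ1⟩, -1, u, fun t => γ * p.Sz t, fun t => γ * (p.Sx t - X), ?_⟩,
    ⟨u, huc, Filter.EventuallyEq.rfl, rfl⟩, hX⟩
  · have hsub : Set.Icc 0 t ⊆ Set.Icc (0 : ℝ) 1 := Set.Icc_subset_Icc_right ht.2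
    have := intervalIntegral.integral_eq_sub_of_hasDerivAt_of_le ht.1 (hθc.mono hsub)
      (fun s hs => (hθ s (hsub ⟨hs.1.le, hs.2.le⟩)).hasDerivAt
        (Icc_mem_nhds hs.1 (hs.2.trans_le ht.2)))
      (ContinuousOn.intervalIntegrable (by rw [Set.uIcc_of_le ht.1]; exact huc.mono hsub))
    rw [hθ0, sub_zero] at this
    exact this.symm
  · refine ⟨by norm_num, Or.inl (by norm_num), ?_, fun t ht => ?_, fun t ht => ?_,
      fun t ht => ?_, ⟨u 0 ^ 2 / 2 - γ * X * Real.sin (2 * θ 0), ?_⟩, ?_, ?_⟩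
    · refine Filter.Eventually.of_forall fun t v => ?_
      simp only [hamiltonian, p]
      nlinarith [sq_nonneg (v - u t)]
    · refine (hu t ht).congr_deriv ?_
      simp only [p]
      ring
    · refine ((hSz t ht).const_mul γ).congr_deriv ?_
      simp only [p]
      ring
    · refine (((hSx t ht).sub_const X).const_mul γ).congr_deriv ?_
      simp only [p]
      ring
    · refine (ae_restrict_iff' measurableSet_Icc).2 (Filter.Eventually.of_forall fun t ht => ?_)
      rw [← hE t ht]
      simp only [hamiltonian, p]
      ring
    · simp only [p, hZ, mul_zero]
    · simp only [p, hX, sub_self, mul_zero]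

/-- The integral is `(u 1 - u 0)/σ`, so the condition `Sz(1) = 0` follows from equal end controls.
-/
theorem integral_cos_eq_zero {σ : ℝ} {θ u : ℝ → ℝ} (hσ : σ ≠ 0)
    (hu : ∀ t ∈ Set.Icc (0 : ℝ) 1,
      HasDerivWithinAt u (σ * Real.cos (2 * θ t)) (Set.Icc 0 1) t)
    (hθc : ContinuousOn θ (Set.Icc 0 1)) (h : u 1 = u 0) :
    ∫ t in (0 : ℝ)..1, Real.cos (2 * θ t) = 0 := by
  have := intervalIntegral.integral_eq_sub_of_hasDerivAt_of_le zero_le_one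
    (fun t ht => (hu t ht).continuousWithinAt)
    (fun t ht => (hu t ⟨ht.1.le, ht.2.le⟩).hasDerivAt (Icc_mem_nhds ht.1 ht.2))
    (ContinuousOn.intervalIntegrable (by rw [Set.uIcc_of_le zero_le_one]; fun_prop))
  rw [intervalIntegral.integral_const_mul, h, sub_self] at this
  exact (mul_eq_zero.1 this).resolve_left hσ

theorem exists_extremal_zero :
    ∃ p : Trajectory, IsExtremal 0 p ∧ HasInitialControl p (Real.pi / 2) ∧
      p.Sx 1 = 2 / Real.pi := by
  have hp := Real.pi_ne_zero
  refine exists_isExtremal (θ := fun t => Real.pi / 2 * t) (u := fun _ => Real.pi / 2)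
    (by simp) (by simp) (fun t _ => ?_) (fun t _ => ?_) ?_ ?_
  · simpa using ((hasDerivAt_id t).const_mul (Real.pi / 2)).hasDerivWithinAt
  · simpa using hasDerivWithinAt_const t (Set.Icc (0 : ℝ) 1) (Real.pi / 2)
  · have e : ∀ t : ℝ, 2 * (Real.pi / 2 * t) = Real.pi * t := fun t => by ring
    simp only [e]
    rw [intervalIntegral.integral_comp_mul_left (fun x => Real.sin x) hp, integral_sin]
    simp
    ring
  · have e : ∀ t : ℝ, 2 * (Real.pi / 2 * t) = Real.pi * t := fun t => by ring
    simp only [e]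
    rw [intervalIntegral.integral_comp_mul_left (fun x => Real.cos x) hp, integral_cos]
    simp

theorem integral_symm_pi {F : ℝ → ℝ} (hF : Continuous F) (h : ∀ x, F (Real.pi - x) = F x)
    (a : ℝ) : ∫ x in a..(Real.pi - a), F x = 2 * ∫ x in a..(Real.pi / 2), F x := by
  have e := intervalIntegral.integral_comp_sub_left (a := a) (b := Real.pi / 2) F Real.pi
  simp only [h] at e
  rw [← intervalIntegral.integral_add_adjacent_intervals (b := Real.pi / 2)
    (hF.intervalIntegrable _ _) (hF.intervalIntegrable _ _)]
  have e2 : Real.pi - Real.pi / 2 = Real.pi / 2 := by ring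
  rw [e2] at e
  linarith

theorem integral_symm_pi_even {F : ℝ → ℝ} (hF : Continuous F) (h : ∀ x, F (Real.pi - x) = F x)
    (h' : ∀ x, F (-x) = F x) (c : ℝ) :
    ∫ x in (-c)..(Real.pi + c), F x =
      2 * ((∫ x in (0 : ℝ)..(Real.pi / 2), F x) + ∫ x in (0 : ℝ)..c, F x) := by
  have e := intervalIntegral.integral_comp_neg (a := 0) (b := c) F
  simp only [h', neg_zero] at e
  rw [show Real.pi + c = Real.pi - -c by ring, integral_symm_pi hF h,
    ← intervalIntegral.integral_add_adjacent_intervals (b := 0)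
    (hF.intervalIntegrable _ _) (hF.intervalIntegrable _ _)]
  linarith

/-- The extremal without turning points. -/
theorem exists_extremal_rotation {γ k : ℝ} (hk : 0 < k)
    (h : 2 * γ * J k = I k ^ 3) :
    ∃ p : Trajectory, IsExtremal γ p ∧ HasInitialControl p (Real.sqrt (k * I k ^ 2)) ∧
      p.Sx 1 = J k / I k := by
  have hI := I_pos hk.le
  have hJ := J_pos hk.le
  set r := I k with hr
  -- The truncation `max (sin φ) 0` keeps the velocity positive everywhere; it is inactive on the
  -- path, where `φ` stays in `[0, π]`.
  set g : ℝ → ℝ := fun φ => 2 * r * Real.sqrt (k + max (Real.sin φ) 0) with hg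
  have hgc : Continuous g := by fun_prop
  have hgp : ∀ φ, 0 < g φ := fun φ => by
    have : 0 < k + max (Real.sin φ) 0 := by positivity
    have := Real.sqrt_pos.2 this
    positivity
  have hgM : ∀ φ, g φ ≤ 2 * r * Real.sqrt (k + 1) := fun φ =>
    mul_le_mul_of_nonneg_left (Real.sqrt_le_sqrt (by
      linarith [max_le (Real.sin_le_one φ) zero_le_one])) (by positivity)
  obtain ⟨φ, hφ, hφt⟩ := exists_flow hgc hgp hgM 0
  have hsym : ∀ φ, g (Real.pi - φ) = g φ := fun φ => by simp only [hg, Real.sin_pi_sub]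
  have hginv : ∀ x ∈ Set.Icc 0 (Real.pi / 2),
      (g x)⁻¹ = (2 * r)⁻¹ * (1 / Real.sqrt (k + Real.sin x)) := fun x hx => by
    have := Real.sin_nonneg_of_nonneg_of_le_pi hx.1 (by linarith [hx.2, Real.pi_pos])
    simp only [hg, max_eq_left this]
    rw [mul_inv, one_div]
  have htime : ∫ z in (0 : ℝ)..Real.pi, (g z)⁻¹ = 1 := by
    have e := integral_symm_pi (F := fun z => (g z)⁻¹) (hgc.inv₀ fun z => (hgp z).ne')
      (fun x => by simp only [hsym]) 0
    rw [sub_zero] at e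
    rw [e, intervalIntegral.integral_congr (g := fun x =>
      (2 * r)⁻¹ * (1 / Real.sqrt (k + Real.sin x))) (fun x hx => hginv x (by
        rwa [Set.uIcc_of_le Real.pi_div_two_pos.le] at hx)),
      intervalIntegral.integral_const_mul]
    change 2 * ((2 * r)⁻¹ * r) = 1
    field_simp
  have h0 : φ 0 = 0 := by simpa using hφt 0
  have h1 : φ 1 = Real.pi := by
    rw [← htime]
    exact hφt Real.pi
  have hmono : Monotone φ := (strictMono_of_deriv_pos fun t => by
    rw [(hφ t).deriv]
    exact hgp _).monotone
  have hsin : ∀ t ∈ Set.Icc (0 : ℝ) 1, 0 ≤ Real.sin (φ t) := fun t ht =>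
    Real.sin_nonneg_of_nonneg_of_le_pi (h0 ▸ hmono ht.1) (h1 ▸ hmono ht.2)
  have hX : ∫ t in (0 : ℝ)..1, Real.sin (φ t) = J k / r := by
    rw [integral_comp_flow Real.continuous_sin hgc hgp hφ, h0, h1]
    have e := integral_symm_pi (F := fun z => Real.sin z * (g z)⁻¹)
      (Real.continuous_sin.mul (hgc.inv₀ fun z => (hgp z).ne'))
      (fun x => by simp only [hsym, Real.sin_pi_sub]) 0
    rw [sub_zero] at e
    rw [e, intervalIntegral.integral_congr (g := fun x =>
      (2 * r)⁻¹ * (Real.sin x / Real.sqrt (k + Real.sin x))) (fun x hx => by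
        simp only
        rw [hginv x (by rwa [Set.uIcc_of_le Real.pi_div_two_pos.le] at hx)]
        ring), intervalIntegral.integral_const_mul]
    change 2 * ((2 * r)⁻¹ * J k) = J k / r
    field_simp
  have hγX : 2 * γ * (J k / r) = r ^ 2 := by
    field_simp
    linarith
  set u : ℝ → ℝ := fun t => g (φ t) / 2 with hudef
  have hu : ∀ t ∈ Set.Icc (0 : ℝ) 1, HasDerivWithinAt u
      (2 * γ * (J k / r) * Real.cos (2 * (φ t / 2))) (Set.Icc 0 1) t := by
    intro t ht
    have hs : 0 < k + Real.sin (φ t) := by linarith [hsin t ht]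
    have heq : ∀ s ∈ Set.Icc (0 : ℝ) 1, u s = r * Real.sqrt (k + Real.sin (φ s)) :=
      fun s hs => by
        simp only [hudef, hg, max_eq_left (hsin s hs)]
        ring
    have hd : HasDerivAt (fun s => r * Real.sqrt (k + Real.sin (φ s))) _ t :=
      (((hφ t).sin.const_add k).sqrt hs.ne').const_mul r
    refine (hd.hasDerivWithinAt.congr heq (heq t ht)).congr_deriv ?_
    have hq := (Real.sqrt_pos.2 hs).ne'
    rw [hγX, mul_div_cancel₀ _ (two_ne_zero' ℝ)]
    simp only [hg, max_eq_left (hsin t ht)]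
    field_simp
  have hu0 : u 0 = Real.sqrt (k * r ^ 2) := by
    rw [Real.sqrt_mul hk.le, Real.sqrt_sq hI.le]
    simp only [hudef, hg, h0, Real.sin_zero, max_self, add_zero]
    ring
  have hu1 : u 1 = u 0 := by
    simp only [hudef, hg, h0, h1, Real.sin_pi, Real.sin_zero]
  have hθ : ∀ t, HasDerivAt (fun t => φ t / 2) (u t) t := fun t => (hφ t).div_const 2
  have hZ := integral_cos_eq_zero (by rw [hγX]; positivity) hu
    (fun t _ => (hθ t).continuousAt.continuousWithinAt) hu1
  rw [← hu0]
  refine exists_isExtremal (θ := fun t => φ t / 2) (by simp [h0]) (by simp [h1])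
    (fun t _ => (hθ t).hasDerivWithinAt) hu ?_ hZ
  simpa only [mul_div_cancel₀ _ (two_ne_zero' ℝ)] using hX

theorem cos_angle {k : ℝ} (h0 : -1 ≤ k) (h1 : k < 1) (ψ : ℝ) : Real.cos (angle k ψ) =
    Real.sqrt (1 + k) * Real.cos ψ * Real.sqrt (2 - (1 + k) * Real.cos ψ ^ 2) := by
  have h := abs_lt.1 (abs_sqrt_mul_cos_lt h0 h1 ψ)
  unfold angle
  have hr := radicand_pos h0 h1 ψ
  have e : 1 - (Real.sqrt ((1 + k) / 2) * Real.cos ψ) ^ 2 =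
      (2 - (1 + k) * Real.cos ψ ^ 2) / 2 := by
    rw [mul_pow, Real.sq_sqrt (by linarith)]
    ring
  rw [Real.cos_pi_div_two_sub, Real.sin_two_mul, Real.sin_arcsin h.1.le h.2.le, Real.cos_arcsin,
    e, Real.sqrt_div' _ two_pos.le, Real.sqrt_div' _ two_pos.le]
  have h2 : Real.sqrt 2 ^ 2 = 2 := Real.sq_sqrt two_pos.le
  field_simp
  rw [h2]
  ring

theorem sqrt_mul_sin_crossing {k : ℝ} (h0 : 0 ≤ k) :
    Real.sqrt (1 + k) * Real.sin (crossing k) = Real.sqrt k := by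
  have hs : 0 ≤ Real.sin (crossing k) := Real.sin_nonneg_of_nonneg_of_le_pi (crossing_nonneg k)
    ((crossing_le k).trans (by linarith [Real.pi_pos]))
  rw [← Real.sqrt_sq hs, ← Real.sqrt_mul (by linarith), Real.sin_sq, cos_crossing h0, div_pow,
    one_pow, Real.sq_sqrt (by linarith)]
  congr 1
  have : 1 + k ≠ 0 := by linarith
  field_simp
  ring

/-- The extremal that turns once on each side. -/
theorem exists_extremal_libration {γ k : ℝ} (hγ : 0 < γ) (hk : 0 ≤ k) (hk1 : k < 1)
    (h : 2 * γ * J₁ k = I₁ k ^ 3) :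
    ∃ p : Trajectory, IsExtremal γ p ∧ HasInitialControl p (-Real.sqrt (k * I₁ k ^ 2)) ∧
      p.Sx 1 = I₁ k ^ 2 / (2 * γ) := by
  have hI := I₁_pos hk hk1
  have hk' : -1 ≤ k := by linarith
  set r := I₁ k with hr
  -- In `ψ` the motion never stops: the turning points are `ψ = 0` and `ψ = π`, where `u = r √(1 +
  -- k) sin ψ` vanishes while `ψ` keeps increasing.
  set g : ℝ → ℝ := fun ψ => r * Real.sqrt (2 - (1 + k) * Real.cos ψ ^ 2) with hg
  have hgc : Continuous g := by fun_prop
  have hgp : ∀ ψ, 0 < g ψ := fun ψ => mul_pos hI (Real.sqrt_pos.2 (radicand_pos hk' hk1 ψ))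
  have hgM : ∀ ψ, g ψ ≤ r * Real.sqrt 2 := fun ψ =>
    mul_le_mul_of_nonneg_left (Real.sqrt_le_sqrt (by
      nlinarith [sq_nonneg (Real.cos ψ)])) hI.le
  have hginv : ∀ ψ, (g ψ)⁻¹ = (2 * r)⁻¹ * density k ψ := fun ψ => by
    simp only [hg, density]
    have := (Real.sqrt_pos.2 (radicand_pos hk' hk1 ψ)).ne'
    field_simp
  obtain ⟨ψ, hψ, hψt⟩ := exists_flow hgc hgp hgM (-crossing k)
  have hdc := continuous_density hk' hk1
  have htime : ∫ z in (-crossing k)..(Real.pi + crossing k), (g z)⁻¹ = 1 := by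
    simp only [hginv]
    rw [intervalIntegral.integral_const_mul, integral_symm_pi_even hdc
      (fun x => by simp only [density, Real.cos_pi_sub, neg_sq])
      (fun x => by simp only [density, Real.cos_neg])]
    have e := I₁_eq_crossing hk hk1
    unfold swing at e
    rw [← e, ← hr]
    field_simp
  have h0 : ψ 0 = -crossing k := by simpa using hψt (-crossing k)
  have h1 : ψ 1 = Real.pi + crossing k := by
    rw [← htime]
    exact hψt _
  have hX : ∫ t in (0 : ℝ)..1, sinAngle k (ψ t) = r ^ 2 / (2 * γ) := by
    rw [integral_comp_flow (continuous_sinAngle k) hgc hgp hψ, h0, h1]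
    simp only [hginv]
    have e : ∀ z, sinAngle k z * ((2 * r)⁻¹ * density k z) =
      (2 * r)⁻¹ * (sinAngle k z * density k z) := fun z => by ring
    simp only [e]
    rw [intervalIntegral.integral_const_mul,
      integral_symm_pi_even (F := fun z => sinAngle k z * density k z)
      ((continuous_sinAngle k).mul hdc)
      (fun x => by simp only [density, sinAngle, Real.cos_pi_sub, neg_sq])
      (fun x => by simp only [density, sinAngle, Real.cos_neg])]
    have e := J₁_eq_crossing hk hk1
    unfold swingMoment at e
    rw [← e]
    field_simp
    linarith
  have hγX : 2 * γ * (r ^ 2 / (2 * γ)) = r ^ 2 := by field_simp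
  set θ : ℝ → ℝ := fun t => angle k (ψ t) / 2 with hθdef
  set u : ℝ → ℝ := fun t => r * (Real.sqrt (1 + k) * Real.sin (ψ t)) with hudef
  have hθ : ∀ t, HasDerivAt θ (u t) t := fun t => by
    refine (((hasDerivAt_angle hk' hk1 (ψ t)).comp t (hψ t)).div_const 2).congr_deriv ?_
    have := (Real.sqrt_pos.2 (radicand_pos hk' hk1 (ψ t))).ne'
    simp only [hudef, hg, density]
    field_simp
  have hθ2 : ∀ t, 2 * θ t = angle k (ψ t) := fun t => by
    simp only [hθdef]
    ring
  have hu : ∀ t ∈ Set.Icc (0 : ℝ) 1, HasDerivWithinAt u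
      (2 * γ * (r ^ 2 / (2 * γ)) * Real.cos (2 * θ t)) (Set.Icc 0 1) t := by
    intro t _
    refine ((((hψ t).sin.const_mul (Real.sqrt (1 + k))).const_mul r).congr_deriv
      ?_).hasDerivWithinAt
    rw [hγX, hθ2, cos_angle hk' hk1]
    simp only [hg]
    ring
  have hu0 : u 0 = -Real.sqrt (k * r ^ 2) := by
    simp only [hudef, h0]
    rw [Real.sin_neg, mul_neg, sqrt_mul_sin_crossing hk, Real.sqrt_mul hk, Real.sqrt_sq hI.le]
    ring
  have hu1 : u 1 = u 0 := by
    simp only [hudef, h0, h1]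
    rw [Real.sin_neg, add_comm Real.pi, Real.sin_add_pi]
  have hZ := integral_cos_eq_zero (by rw [hγX]; positivity) hu
    (fun t _ => (hθ t).continuousAt.continuousWithinAt) hu1
  rw [← hu0]
  have hneg : angle k (-crossing k) = angle k (crossing k) := by
    unfold angle
    rw [Real.cos_neg]
  have hpi : angle k (Real.pi + crossing k) = Real.pi - angle k (crossing k) := by
    unfold angle
    rw [add_comm Real.pi, Real.cos_add_pi, mul_neg, Real.arcsin_neg]
    ring
  refine exists_isExtremal (θ := θ) ?_ ?_ (fun t _ => (hθ t).hasDerivWithinAt) hu ?_ hZ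
  · simp only [hθdef, h0, hneg, angle_crossing hk, zero_div]
  · simp only [hθdef, h1, hpi, angle_crossing hk, sub_zero]
  · simpa only [hθ2, sin_angle hk' hk1] using hX

/-- The simplest extremal exists for every weight. -/
theorem exists_isSimplestExtremal {γ : ℝ} (hγ : 0 ≤ γ) :
    ∃ q : Trajectory, IsSimplestExtremal γ q := by
  have hI := I_pos le_rfl
  have hJ := J_pos le_rfl
  have hγc : 0 < γc := by
    unfold γc
    positivity
  rcases hγ.eq_or_lt with rfl | hpos
  · obtain ⟨p, hp, hc, hS⟩ := exists_extremal_zero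
    exact ⟨p, hp, _, _, Or.inl ⟨rfl, rfl, rfl⟩, hc, hS⟩
  rcases lt_trichotomy γ γc with hlt | heq | hgt
  · obtain ⟨k, hk, hkγ⟩ := exists_I_J hpos hlt
    obtain ⟨p, hp, hc, hS⟩ := exists_extremal_rotation hk hkγ
    exact ⟨p, hp, _, _, Or.inr (Or.inl ⟨hpos, hlt, k, hk, hkγ, rfl, rfl⟩), hc, hS⟩
  · have e : 2 * γ * J 0 = I 0 ^ 3 := by
      rw [heq, γc]
      field_simp
    -- At `γc` both families have the limit `k = 0`; the uniformized construction covers this value,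
    -- where `c = 0`.
    obtain ⟨p, hp, hc, hS⟩ := exists_extremal_libration (k := 0) hpos le_rfl one_pos
      (by rw [I₁_zero, J₁_zero, e])
    refine ⟨p, hp, 0, J 0 / I 0, Or.inr (Or.inr (Or.inl ⟨heq, rfl, rfl⟩)), by simpa using hc, ?_⟩
    rw [hS, I₁_zero]
    field_simp
    linarith
  · obtain ⟨k, hk, hk1, hkγ⟩ := exists_I₁_J₁ hgt
    obtain ⟨p, hp, hc, hS⟩ := exists_extremal_libration hpos hk.le hk1 hkγ
    exact ⟨p, hp, _, _, Or.inr (Or.inr (Or.inr ⟨hgt, k, hk, hk1, hkγ, rfl, rfl⟩)), hc, hS⟩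

/-! ### From the maximum principle to the pendulum equation. -/

/-- The equations satisfied by an extremal, with the continuous representative `U` of the
control. -/
structure IsPendulum (γ c : ℝ) (p : Trajectory) (U : ℝ → ℝ) : Prop where
  init : U 0 = c
  ae_eq : p.u =ᵐ[volume.restrict (Set.Icc 0 1)] U
  θ_zero : p.θ 0 = 0
  θ_one : p.θ 1 = Real.pi / 2
  deriv_θ : ∀ t ∈ Set.Icc (0 : ℝ) 1, HasDerivWithinAt p.θ (U t) (Set.Icc 0 1) t
  deriv_U : ∀ t ∈ Set.Icc (0 : ℝ) 1, HasDerivWithinAt U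
    (2 * γ * p.Sx 1 * Real.cos (2 * p.θ t) - 2 * γ * p.Sz 1 * Real.sin (2 * p.θ t))
    (Set.Icc 0 1) t
  Sz_one : p.Sz 1 = ∫ s in (0 : ℝ)..1, Real.cos (2 * p.θ s)
  Sx_one : p.Sx 1 = ∫ s in (0 : ℝ)..1, Real.sin (2 * p.θ s)

/-- The costate equation makes `l + μ₀ γ S` constant in time, and transversality evaluates it at
`1`. It serves for both sensitivity components. -/
theorem multiplier_add_eq {γ μ₀ : ℝ} {θ S l : ℝ → ℝ} {F : ℝ → ℝ}
    (hf : ContinuousOn (fun t => F (2 * θ t)) (Set.Icc 0 1))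
    (hS : ∀ t ∈ Set.Icc (0 : ℝ) 1, S t = ∫ s in (0 : ℝ)..t, F (2 * θ s))
    (hl : ∀ t ∈ Set.Icc (0 : ℝ) 1,
      HasDerivWithinAt l (-(μ₀ * γ * F (2 * θ t))) (Set.Icc 0 1) t)
    (h1 : l 1 = 0) {t : ℝ} (ht : t ∈ Set.Icc (0 : ℝ) 1) :
    l t + μ₀ * γ * S t = μ₀ * γ * S 1 := by
  have hd : ∀ s ∈ Set.Icc (0 : ℝ) 1,
      HasDerivWithinAt (fun s => l s + μ₀ * γ * S s) 0 (Set.Icc 0 1) s := fun s hs => by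
    have := ((hasDerivWithinAt_integral hf s hs).congr hS (hS s hs)).const_mul (μ₀ * γ)
    refine ((hl s hs).add this).congr_deriv ?_
    ring
  have e1 := eq_of_hasDerivWithinAt_zero hd ht
  have e2 := eq_of_hasDerivWithinAt_zero hd (Set.right_mem_Icc.2 zero_le_one)
  simp only [h1, zero_add] at e1 e2
  rw [e1, e2]

theorem IsExtremal.exists_isPendulum {γ c : ℝ} {p : Trajectory} (hp : IsExtremal γ p)
    (hc : HasInitialControl p c) : ∃ U, IsPendulum γ c p U := by
  obtain ⟨ha, μ₀, lθ, lz, lx, hm⟩ := hp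
  obtain ⟨w, hwc, hw, hw0⟩ := hc
  have hθ0 : p.θ 0 = 0 := by
    rw [ha.θ_eq 0 (Set.left_mem_Icc.2 zero_le_one), intervalIntegral.integral_same]
  have hint : ∀ t ∈ Set.Icc (0 : ℝ) 1, p.θ t = ∫ s in (0 : ℝ)..t, w s := fun t ht => by
    rw [ha.θ_eq t ht, intervalIntegral.integral_of_le ht.1, intervalIntegral.integral_of_le ht.1]
    refine integral_congr_ae (ae_mono (Measure.restrict_mono ?_ le_rfl) hw)
    exact Set.Ioc_subset_Icc_self.trans (Set.Icc_subset_Icc_right ht.2)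
  have hdθ : ∀ t ∈ Set.Icc (0 : ℝ) 1, HasDerivWithinAt p.θ (w t) (Set.Icc 0 1) t :=
    fun t ht => (hasDerivWithinAt_integral hwc t ht).congr hint (hint t ht)
  have hθc : ContinuousOn p.θ (Set.Icc 0 1) := fun t ht => (hdθ t ht).continuousWithinAt
  have hlc : ContinuousOn lθ (Set.Icc 0 1) := fun t ht => (hm.costate_θ t ht).continuousWithinAt
  have hμ : μ₀ ≠ 0 := by
    rintro rfl
    have hz : ∀ᵐ t ∂(volume.restrict (Set.Icc (0 : ℝ) 1)), lθ t = 0 := by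
      filter_upwards [hm.maximality] with t ht
      -- With `μ₀ = 0` the Hamiltonian is affine in `v` with slope `lθ`, so this test value gives
      -- `lθ² ≤ 0`.
      have := ht (p.u t + lθ t)
      simp only [hamiltonian] at this
      nlinarith [sq_nonneg (lθ t)]
    have hz' := Measure.eqOn_Icc_of_ae_eq (g := fun _ => (0 : ℝ)) volume zero_ne_one hz hlc
      continuousOn_const
    rcases hm.nontrivial with h | ⟨t, ht, h⟩
    · exact h rfl
    · have e1 := multiplier_add_eq (F := Real.cos) (by fun_prop) ha.Sz_eq hm.costate_z
        hm.transversality_z ht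
      have e2 := multiplier_add_eq (F := Real.sin) (by fun_prop) ha.Sx_eq hm.costate_x
        hm.transversality_x ht
      simp only [zero_mul, add_zero] at e1 e2
      rcases h with h | h | h
      exacts [h (hz' ht), h e1, h e2]
  have hμneg : μ₀ < 0 := lt_of_le_of_ne hm.nonpos hμ
  have hu : p.u =ᵐ[volume.restrict (Set.Icc 0 1)] fun t => -lθ t / μ₀ := by
    filter_upwards [hm.maximality] with t ht
    -- The vertex of the concave parabola in `v`; comparing with it forces the control to equal it.
    have := ht (-lθ t / μ₀)
    simp only [hamiltonian] at this
    have e : lθ t = -(μ₀ * (-lθ t / μ₀)) := by field_simp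
    set v := -lθ t / μ₀
    rw [e] at this
    have h2 : (-μ₀) * (p.u t - v) ^ 2 ≤ 0 := by nlinarith
    have h3 : (p.u t - v) ^ 2 ≤ 0 := by
      by_contra h
      nlinarith
    have := pow_eq_zero_iff (two_ne_zero) |>.1 (le_antisymm h3 (sq_nonneg _))
    linarith
  have hwU : Set.EqOn w (fun t => -lθ t / μ₀) (Set.Icc 0 1) :=
    Measure.eqOn_Icc_of_ae_eq volume zero_ne_one (hw.symm.trans hu) hwc
      (hlc.neg.div_const _)
  refine ⟨w, hw0, hw, hθ0, ha.θ_final, hdθ, fun t ht => ?_,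
    ha.Sz_eq 1 (Set.right_mem_Icc.2 zero_le_one), ha.Sx_eq 1 (Set.right_mem_Icc.2 zero_le_one)⟩
  refine (((hm.costate_θ t ht).neg.div_const μ₀).congr hwU (hwU ht)).congr_deriv ?_
  rw [multiplier_add_eq (F := Real.cos) (by fun_prop) ha.Sz_eq hm.costate_z
      hm.transversality_z ht, multiplier_add_eq (F := Real.sin) (by fun_prop) ha.Sx_eq hm.costate_x
      hm.transversality_x ht]
  field_simp
  ring

namespace IsPendulum

variable {γ c : ℝ} {p : Trajectory} {U : ℝ → ℝ}

theorem continuousOn_θ (h : IsPendulum γ c p U) : ContinuousOn p.θ (Set.Icc 0 1) :=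
  fun t ht => (h.deriv_θ t ht).continuousWithinAt

theorem continuousOn_U (h : IsPendulum γ c p U) : ContinuousOn U (Set.Icc 0 1) :=
  fun t ht => (h.deriv_U t ht).continuousWithinAt

theorem intervalIntegrable_trig (h : IsPendulum γ c p U) {F : ℝ → ℝ} (hF : Continuous F) :
    IntervalIntegrable (fun t => F (2 * p.θ t)) volume 0 1 := by
  have := h.continuousOn_θ
  refine ContinuousOn.intervalIntegrable ?_
  rw [Set.uIcc_of_le zero_le_one]
  fun_prop

/-- Integrating the equation for `U` over `[0, 1]` produces `2γ (Sx Sz - Sz Sx) = 0` at the final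
time. -/
theorem U_one (h : IsPendulum γ c p U) : U 1 = c := by
  have hi := fun a => (h.intervalIntegrable_trig Real.continuous_cos).const_mul a
  have hi' := fun a => (h.intervalIntegrable_trig Real.continuous_sin).const_mul a
  have := intervalIntegral.integral_eq_sub_of_hasDerivAt_of_le zero_le_one h.continuousOn_U
    (fun t ht => (h.deriv_U t ⟨ht.1.le, ht.2.le⟩).hasDerivAt (Icc_mem_nhds ht.1 ht.2))
    ((hi _).sub (hi' _))
  rw [intervalIntegral.integral_sub (hi _) (hi' _), intervalIntegral.integral_const_mul,
    intervalIntegral.integral_const_mul, ← h.Sz_one, ← h.Sx_one, h.init] at this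
  linarith

theorem energy (h : IsPendulum γ c p U) {t : ℝ} (ht : t ∈ Set.Icc (0 : ℝ) 1) :
    U t ^ 2 - 2 * γ * p.Sx 1 * Real.sin (2 * p.θ t) - 2 * γ * p.Sz 1 * Real.cos (2 * p.θ t) =
      c ^ 2 - 2 * γ * p.Sz 1 := by
  have := eq_of_hasDerivWithinAt_zero (f := fun t => U t ^ 2 -
    2 * γ * p.Sx 1 * Real.sin (2 * p.θ t) - 2 * γ * p.Sz 1 * Real.cos (2 * p.θ t))
    (fun s hs => ?_) ht
  · simpa [h.init, h.θ_zero] using this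
  · refine ((((h.deriv_U s hs).pow 2).sub
      (((h.deriv_θ s hs).const_mul 2).sin.const_mul _)).sub
      (((h.deriv_θ s hs).const_mul 2).cos.const_mul _)).congr_deriv ?_
    push_cast
    ring

/-- Since `U 1 = U 0`, equating the energies at `2θ = 0` and `2θ = π` leaves only the cosine term,
which changes sign. -/
theorem Sz_eq_zero (h : IsPendulum γ c p U) : γ * p.Sz 1 = 0 := by
  have := h.energy (Set.right_mem_Icc.2 zero_le_one)
  rw [h.U_one, h.θ_one, mul_div_cancel₀ _ (two_ne_zero' ℝ)] at this
  simp only [Real.sin_pi, Real.cos_pi] at this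
  linarith

theorem U_sq (h : IsPendulum γ c p U) {t : ℝ} (ht : t ∈ Set.Icc (0 : ℝ) 1) :
    U t ^ 2 = c ^ 2 + 2 * γ * p.Sx 1 * Real.sin (2 * p.θ t) := by
  have := h.energy ht
  rw [mul_assoc 2 γ (p.Sz 1), h.Sz_eq_zero] at this
  linarith

theorem deriv_U' (h : IsPendulum γ c p U) {t : ℝ} (ht : t ∈ Set.Icc (0 : ℝ) 1) :
    HasDerivWithinAt U (2 * γ * p.Sx 1 * Real.cos (2 * p.θ t)) (Set.Icc 0 1) t := by
  have := h.deriv_U t ht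
  rwa [mul_assoc 2 γ (p.Sz 1), h.Sz_eq_zero, mul_zero, zero_mul, sub_zero] at this

theorem cost_eq (h : IsPendulum γ c p U) (hγ : 0 < γ) :
    cost γ p = c ^ 2 / 2 + 3 / 2 * γ * p.Sx 1 ^ 2 := by
  have hZ : p.Sz 1 = 0 := (mul_eq_zero.1 h.Sz_eq_zero).resolve_left hγ.ne'
  have hu : ∫ t in (0 : ℝ)..1, p.u t ^ 2 = c ^ 2 + 2 * γ * p.Sx 1 ^ 2 := by
    have e : ∫ t in (0 : ℝ)..1, p.u t ^ 2 =
        ∫ t in (0 : ℝ)..1, (c ^ 2 + 2 * γ * p.Sx 1 * Real.sin (2 * p.θ t)) := by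
      rw [intervalIntegral.integral_of_le zero_le_one, intervalIntegral.integral_of_le zero_le_one]
      refine integral_congr_ae ?_
      filter_upwards [ae_mono (Measure.restrict_mono Set.Ioc_subset_Icc_self le_rfl) h.ae_eq,
        ae_restrict_mem measurableSet_Ioc] with t ht hmem
      rw [ht, h.U_sq ⟨hmem.1.le, hmem.2⟩]
    rw [e, intervalIntegral.integral_add intervalIntegrable_const
      ((h.intervalIntegrable_trig Real.continuous_sin).const_mul _),
      intervalIntegral.integral_const_mul, ← h.Sx_one]
    simp
    ring
  rw [cost, hu, hZ]
  ring

theorem initial_eq_of_zero (h : IsPendulum 0 c p U) : c = Real.pi / 2 := by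
  have hd : ∀ t ∈ Set.Icc (0 : ℝ) 1,
      HasDerivWithinAt (fun t => p.θ t - c * t) 0 (Set.Icc 0 1) t := fun t ht => by
    have hU : U t = c := by
      rw [← h.init]
      refine eq_of_hasDerivWithinAt_zero (fun s hs => ?_) ht
      simpa using h.deriv_U s hs
    refine ((h.deriv_θ t ht).sub ((hasDerivWithinAt_id t _).const_mul c)).congr_deriv ?_
    rw [hU]
    ring
  have := eq_of_hasDerivWithinAt_zero hd (Set.right_mem_Icc.2 zero_le_one)
  simp only [h.θ_zero, h.θ_one] at this
  linarith

/-! ### Turning points and length of an extremal with negative initial control. -/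

/-- The velocity is `c < 0` at both ends, so `θ` dips below its initial value and arrives at `π/2`
from above. -/
theorem exists_lt_of_deriv_neg (h : IsPendulum γ c p U) (hc : c < 0) :
    (∃ t ∈ Set.Icc (0 : ℝ) 1, p.θ t < 0) ∧ ∃ t ∈ Set.Icc (0 : ℝ) 1, Real.pi / 2 < p.θ t := by
  constructor
  · have h0 := (h.deriv_θ 0 (Set.left_mem_Icc.2 zero_le_one)).mono
      (show Set.Ioc (0 : ℝ) 1 ⊆ _ from Set.Ioc_subset_Icc_self)
    rw [h.init] at h0
    have := left_nhdsWithin_Ioc_neBot (zero_lt_one' ℝ)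
    obtain ⟨t, ht, htm⟩ := ((h0.limsup_slope_le' (by simp) hc).and self_mem_nhdsWithin).exists
    refine ⟨t, ⟨htm.1.le, htm.2⟩, ?_⟩
    rw [slope_def_field, h.θ_zero, sub_zero, sub_zero] at ht
    by_contra hn
    exact absurd ht (not_lt.2 (div_nonneg (not_lt.1 hn) htm.1.le))
  · have h1 := (h.deriv_θ 1 (Set.right_mem_Icc.2 zero_le_one)).mono
      (show Set.Ico (0 : ℝ) 1 ⊆ _ from Set.Ico_subset_Icc_self)
    rw [h.U_one] at h1
    have := right_nhdsWithin_Ico_neBot (zero_lt_one' ℝ)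
    obtain ⟨t, ht, htm⟩ := ((h1.limsup_slope_le' (by simp) hc).and self_mem_nhdsWithin).exists
    refine ⟨t, ⟨htm.1, htm.2.le⟩, ?_⟩
    rw [slope_def_field, h.θ_one] at ht
    by_contra hn
    exact absurd ht (not_lt.2 (div_nonneg_of_nonpos (by linarith) (by linarith [htm.2])))

/-- An extremal with negative initial control turns below `0` and above `π / 2`. -/
theorem exists_turning (h : IsPendulum γ c p U) (hc : c < 0) :
    (∃ t ∈ Set.Icc (0 : ℝ) 1, p.θ t ≤ 0 ∧ U t = 0) ∧
      ∃ t ∈ Set.Icc (0 : ℝ) 1, Real.pi / 2 ≤ p.θ t ∧ U t = 0 := by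
  have hpi := Real.pi_div_two_pos
  obtain ⟨⟨s, hs, hsθ⟩, ⟨s', hs', hsθ'⟩⟩ := h.exists_lt_of_deriv_neg hc
  have hne : (Set.Icc (0 : ℝ) 1).Nonempty := ⟨s, hs⟩
  have hinterior : ∀ t ∈ Set.Icc (0 : ℝ) 1, p.θ t ≠ 0 → p.θ t ≠ Real.pi / 2 →
      t ∈ Set.Ioo (0 : ℝ) 1 := fun t ht h0 h1 =>
    ⟨ht.1.lt_of_ne fun e => h0 (by rw [← e, h.θ_zero]),
      ht.2.lt_of_ne fun e => h1 (by rw [e, h.θ_one])⟩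
  obtain ⟨t₁, ht₁, hmin⟩ := isCompact_Icc.exists_isMinOn hne h.continuousOn_θ
  obtain ⟨t₂, ht₂, hmax⟩ := isCompact_Icc.exists_isMaxOn hne h.continuousOn_θ
  have hθ₁ : p.θ t₁ < 0 := (hmin hs).trans_lt hsθ
  have hθ₂ : Real.pi / 2 < p.θ t₂ := hsθ'.trans_le (hmax hs')
  have hi₁ := hinterior t₁ ht₁ hθ₁.ne (by linarith)
  have hi₂ := hinterior t₂ ht₂ (by linarith) hθ₂.ne'
  refine ⟨⟨t₁, ht₁, hθ₁.le, ?_⟩, ⟨t₂, ht₂, hθ₂.le, ?_⟩⟩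
  · have hn := Icc_mem_nhds hi₁.1 hi₁.2
    exact (hmin.isLocalMin hn).hasDerivAt_eq_zero ((h.deriv_θ t₁ ht₁).hasDerivAt hn)
  · have hn := Icc_mem_nhds hi₂.1 hi₂.2
    exact (hmax.isLocalMax hn).hasDerivAt_eq_zero ((h.deriv_θ t₂ ht₂).hasDerivAt hn)

/-- At a turning point `c² = -σ sin 2θ`, so `c² ≤ |σ|`. Equality is the separatrix, on which a
vanishing velocity stays zero, against `U 1 = c < 0`. A negative `σ` would make `U²` negative where
`θ = π/4`. -/
theorem sq_lt_of_neg (h : IsPendulum γ c p U) (hc : c < 0) : c ^ 2 < 2 * γ * p.Sx 1 := by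
  obtain ⟨-, t₀, ht₀, -, hU⟩ := h.exists_turning hc
  set σ := 2 * γ * p.Sx 1 with hσ
  have hsq := h.U_sq ht₀
  rw [hU, ← hσ] at hsq
  have habs : c ^ 2 < |σ| := by
    have hle : c ^ 2 ≤ |σ| := by
      have h1 : |σ * Real.sin (2 * p.θ t₀)| ≤ |σ| := by
        rw [abs_mul]
        exact mul_le_of_le_one_right (abs_nonneg _) (Real.abs_sin_le_one _)
      linarith [neg_abs_le (σ * Real.sin (2 * p.θ t₀))]
    refine lt_of_le_of_ne hle fun heq => ?_
    -- Grönwall: on the separatrix `U'² = (|σ| + σ sin)(|σ| - σ sin) ≤ 2|σ| U²`.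
    have hz := eq_zero_of_abs_deriv_le_mul_abs_self_of_eq_zero_right (f := U)
      (f' := fun t => σ * Real.cos (2 * p.θ t)) (K := Real.sqrt (2 * |σ|)) (a := t₀) (b := 1)
      (h.continuousOn_U.mono (Set.Icc_subset_Icc_left ht₀.1)) (fun t ht => ?_) hU
      (fun t ht => ?_) 1 (Set.right_mem_Icc.2 ht₀.2)
    · rw [h.U_one] at hz
      linarith
    · have htm : t ∈ Set.Icc (0 : ℝ) 1 := ⟨ht₀.1.trans ht.1, ht.2.le⟩
      exact (h.deriv_U' htm).mono_of_mem_nhdsWithin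
        (Filter.mem_of_superset (Icc_mem_nhdsGE ht.2) (Set.Icc_subset_Icc_left htm.1))
    · have htm : t ∈ Set.Icc (0 : ℝ) 1 := ⟨ht₀.1.trans ht.1, ht.2.le⟩
      rw [Real.norm_eq_abs, Real.norm_eq_abs]
      refine abs_le_of_sq_le_sq ?_ (by positivity)
      rw [mul_pow σ, mul_pow (Real.sqrt _), Real.sq_sqrt (by positivity), sq_abs,
        h.U_sq htm, ← hσ, heq,
        Real.cos_sq']
      have h1 := neg_abs_le σ
      have h2 := le_abs_self σ
      have h3 := Real.sin_le_one (2 * p.θ t)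
      have h4 := Real.neg_one_le_sin (2 * p.θ t)
      have h5 : 0 ≤ |σ| + σ * Real.sin (2 * p.θ t) := by
        rw [← heq, hσ, ← h.U_sq htm]
        positivity
      nlinarith [sq_abs σ, mul_nonneg h5 h5]
  rcases le_or_gt 0 σ with h0 | h0
  · rwa [abs_of_nonneg h0] at habs
  · exfalso
    rw [abs_of_neg h0] at habs
    obtain ⟨t, ht, hθ⟩ := intermediate_value_Icc zero_le_one h.continuousOn_θ
      (show Real.pi / 4 ∈ Set.Icc (p.θ 0) (p.θ 1) by
        rw [h.θ_zero, h.θ_one]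
        constructor <;> linarith [Real.pi_pos])
    have := h.U_sq ht
    rw [hθ, show 2 * (Real.pi / 4) = Real.pi / 2 by ring, Real.sin_pi_div_two, ← hσ] at this
    nlinarith [sq_nonneg (U t)]

/-- The turning points of an extremal with negative initial control. -/
theorem exists_turning_angle (h : IsPendulum γ c p U) (hc : c < 0) {k : ℝ}
    (hk : c ^ 2 = k * (2 * γ * p.Sx 1)) :
    (∃ t ∈ Set.Icc (0 : ℝ) 1, 2 * p.θ t = -Real.arcsin k) ∧
      ∃ t ∈ Set.Icc (0 : ℝ) 1, 2 * p.θ t = Real.pi + Real.arcsin k := by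
  have hlt := h.sq_lt_of_neg hc
  have hpi := Real.pi_pos
  set σ := 2 * γ * p.Sx 1 with hσ
  have hσ0 : 0 < σ := (sq_nonneg c).trans_lt hlt
  have hsin : ∀ t ∈ Set.Icc (0 : ℝ) 1, U t = 0 → Real.sin (2 * p.θ t) = -k := fun t ht hU => by
    have := h.U_sq ht
    rw [hU, ← hσ, hk] at this
    have h2 : σ * (k + Real.sin (2 * p.θ t)) = 0 := by linarith
    linarith [(mul_eq_zero.1 h2).resolve_left hσ0.ne']
  -- The sine never reaches `-1`, so by continuity `2θ` is confined between `-π/2` and `3π/2`, where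
  -- `sin = -k` determines each turning angle.
  have hnot : ∀ t ∈ Set.Icc (0 : ℝ) 1, Real.sin (2 * p.θ t) ≠ -1 := fun t ht hs => by
    have := h.U_sq ht
    rw [hs, ← hσ] at this
    nlinarith [sq_nonneg (U t)]
  obtain ⟨⟨t₁, ht₁, hθ₁, hU₁⟩, ⟨t₂, ht₂, hθ₂, hU₂⟩⟩ := h.exists_turning hc
  constructor
  · refine ⟨t₁, ht₁, ?_⟩
    have hlow : -(Real.pi / 4) ≤ p.θ t₁ := by
      by_contra hlt
      obtain ⟨s, hs, hsθ⟩ := intermediate_value_Icc' ht₁.1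
        (h.continuousOn_θ.mono (Set.Icc_subset_Icc_right ht₁.2))
        (show -(Real.pi / 4) ∈ Set.Icc (p.θ t₁) (p.θ 0) by
          rw [h.θ_zero]
          exact ⟨(not_le.1 hlt).le, by linarith⟩)
      refine hnot s ⟨hs.1, hs.2.trans ht₁.2⟩ ?_
      rw [hsθ, show 2 * -(Real.pi / 4) = -(Real.pi / 2) by ring, Real.sin_neg,
        Real.sin_pi_div_two]
    rw [← Real.arcsin_neg, ← hsin t₁ ht₁ hU₁, Real.arcsin_sin] <;> linarith
  · refine ⟨t₂, ht₂, ?_⟩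
    have hup : p.θ t₂ ≤ 3 * (Real.pi / 4) := by
      by_contra hlt
      obtain ⟨s, hs, hsθ⟩ := intermediate_value_Icc' ht₂.2
        (h.continuousOn_θ.mono (Set.Icc_subset_Icc_left ht₂.1))
        (show 3 * (Real.pi / 4) ∈ Set.Icc (p.θ 1) (p.θ t₂) by
          rw [h.θ_one]
          exact ⟨by linarith, (not_le.1 hlt).le⟩)
      refine hnot s ⟨ht₂.1.trans hs.1, hs.2⟩ ?_
      rw [hsθ, show 2 * (3 * (Real.pi / 4)) = Real.pi / 2 + Real.pi by ring, Real.sin_add_pi,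
        Real.sin_pi_div_two]
    have e : Real.pi - 2 * p.θ t₂ = -Real.arcsin k := by
      rw [← Real.arcsin_neg, ← hsin t₂ ht₂ hU₂, ← Real.sin_pi_sub, Real.arcsin_sin] <;> linarith
    linarith

theorem abs_integral_le (h : IsPendulum γ c p U) {f : ℝ → ℝ} (hf : Continuous f)
    (hf0 : ∀ x, 0 ≤ f x) {s t : ℝ} (hs : 0 ≤ s) (hst : s ≤ t) (ht : t ≤ 1) :
    |∫ x in (2 * p.θ s)..(2 * p.θ t), f x| ≤ ∫ x in s..t, f (2 * p.θ x) * |2 * U x| := by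
  have hsub : Set.Icc s t ⊆ Set.Icc (0 : ℝ) 1 := Set.Icc_subset_Icc hs ht
  have hθc := h.continuousOn_θ.mono hsub
  have hUc := h.continuousOn_U.mono hsub
  have e := intervalIntegral.integral_comp_mul_deriv'' (a := s) (b := t)
    (f := fun x => 2 * p.θ x) (f' := fun x => 2 * U x) (g := f)
    (by rw [Set.uIcc_of_le hst]; fun_prop) (fun x hx => ?_)
    (by rw [Set.uIcc_of_le hst]; fun_prop) hf.continuousOn
  · rw [← e]
    refine (intervalIntegral.abs_integral_le_integral_abs hst).trans_eq ?_
    refine intervalIntegral.integral_congr fun x _ => ?_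
    simp only [Function.comp, abs_mul, abs_of_nonneg (hf0 _)]
  · rw [min_eq_left hst, max_eq_right hst] at hx
    exact (((h.deriv_θ x (hsub ⟨hx.1.le, hx.2.le⟩)).hasDerivAt
      (Icc_mem_nhds (hs.trans_lt hx.1) (hx.2.trans_le ht))).const_mul 2).hasDerivWithinAt

/-- The length of an extremal with negative initial control, for a metric that is symmetric
about `π / 2`. -/
theorem length_le (h : IsPendulum γ c p U) (hc : c < 0) {k : ℝ}
    (hk : c ^ 2 = k * (2 * γ * p.Sx 1)) (hk0 : 0 ≤ k) {f : ℝ → ℝ} (hf : Continuous f)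
    (hf0 : ∀ x, 0 ≤ f x) (hsym : ∀ x, f (Real.pi - x) = f x) :
    2 * (2 * (∫ x in (-Real.arcsin k)..0, f x) + ∫ x in (0 : ℝ)..(Real.pi / 2), f x) ≤
      ∫ t in (0 : ℝ)..1, f (2 * p.θ t) * |2 * U t| := by
  obtain ⟨⟨t₁, ht₁, hθ₁⟩, ⟨t₂, ht₂, hθ₂⟩⟩ := h.exists_turning_angle hc hk
  have hθc := h.continuousOn_θ
  have hUc := h.continuousOn_U
  have hi : ∀ a ∈ Set.Icc (0 : ℝ) 1, ∀ b ∈ Set.Icc (0 : ℝ) 1,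
      IntervalIntegrable (fun t => f (2 * p.θ t) * |2 * U t|) volume a b := fun a ha b hb => by
    have : ContinuousOn (fun t => f (2 * p.θ t) * |2 * U t|) (Set.Icc 0 1) := by fun_prop
    exact (this.mono (Set.uIcc_subset_Icc ha hb)).intervalIntegrable
  have hif : ∀ a b : ℝ, IntervalIntegrable f volume a b := fun a b => hf.intervalIntegrable a b
  have h0m : (0 : ℝ) ∈ Set.Icc (0 : ℝ) 1 := Set.left_mem_Icc.2 zero_le_one
  have h1m : (1 : ℝ) ∈ Set.Icc (0 : ℝ) 1 := Set.right_mem_Icc.2 zero_le_one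
  have hθ0 : 2 * p.θ 0 = 0 := by rw [h.θ_zero, mul_zero]
  have hθ1 : 2 * p.θ 1 = Real.pi := by rw [h.θ_one, mul_div_cancel₀ _ (two_ne_zero' ℝ)]
  set m := Real.arcsin k with hm
  have hm0 : 0 ≤ m := Real.arcsin_nonneg.2 hk0
  set F₁ := ∫ x in (-m)..0, f x with hF₁
  set F₂ := ∫ x in (0 : ℝ)..(Real.pi / 2), f x with hF₂
  have hF₁0 : 0 ≤ F₁ := intervalIntegral.integral_nonneg (by linarith) fun x _ => hf0 x
  have hF₂0 : 0 ≤ F₂ := intervalIntegral.integral_nonneg Real.pi_div_two_pos.le fun x _ => hf0 x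
  have e1 : ∫ x in (0 : ℝ)..Real.pi, f x = 2 * F₂ := by
    simpa using integral_symm_pi hf hsym 0
  have e2 : ∫ x in (-m)..(Real.pi + m), f x = 2 * F₁ + 2 * F₂ := by
    rw [show Real.pi + m = Real.pi - -m by ring, integral_symm_pi hf hsym,
      ← intervalIntegral.integral_add_adjacent_intervals (hif _ 0) (hif 0 _)]
    ring
  have e3 : ∫ x in (0 : ℝ)..(Real.pi + m), f x = F₁ + 2 * F₂ := by
    have := intervalIntegral.integral_add_adjacent_intervals (hif (-m) 0) (hif 0 (Real.pi + m))
    linarith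
  have e4 : ∫ x in Real.pi..(Real.pi + m), f x = F₁ := by
    have := intervalIntegral.integral_add_adjacent_intervals (hif 0 Real.pi)
      (hif Real.pi (Real.pi + m))
    linarith
  have e5 : ∫ x in (-m)..Real.pi, f x = F₁ + 2 * F₂ := by
    have := intervalIntegral.integral_add_adjacent_intervals (hif (-m) 0) (hif 0 Real.pi)
    linarith
  -- If the lower turn comes first, the three legs give exactly the bound; in the other order the
  -- outer legs are longer.
  rcases le_total t₁ t₂ with hle | hle
  · have a1 := h.abs_integral_le hf hf0 le_rfl ht₁.1 ht₁.2
    have a2 := h.abs_integral_le hf hf0 ht₁.1 hle ht₂.2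
    have a3 := h.abs_integral_le hf hf0 ht₂.1 ht₂.2 le_rfl
    rw [hθ0, hθ₁, intervalIntegral.integral_symm, abs_neg] at a1
    rw [hθ₁, hθ₂, e2] at a2
    rw [hθ₂, hθ1, intervalIntegral.integral_symm, abs_neg, e4] at a3
    have s1 := intervalIntegral.integral_add_adjacent_intervals (hi 0 h0m t₁ ht₁)
      (hi t₁ ht₁ t₂ ht₂)
    have s2 := intervalIntegral.integral_add_adjacent_intervals (hi 0 h0m t₂ ht₂)
      (hi t₂ ht₂ 1 h1m)
    linarith [le_abs_self F₁, le_abs_self (2 * F₁ + 2 * F₂)]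
  · have a1 := h.abs_integral_le hf hf0 le_rfl ht₂.1 ht₂.2
    have a2 := h.abs_integral_le hf hf0 ht₂.1 hle ht₁.2
    have a3 := h.abs_integral_le hf hf0 ht₁.1 ht₁.2 le_rfl
    rw [hθ0, hθ₂, e3] at a1
    rw [hθ₁, hθ₂, intervalIntegral.integral_symm, abs_neg, e2] at a2
    rw [hθ₁, hθ1, e5] at a3
    have s1 := intervalIntegral.integral_add_adjacent_intervals (hi 0 h0m t₂ ht₂)
      (hi t₂ ht₂ t₁ ht₁)
    have s2 := intervalIntegral.integral_add_adjacent_intervals (hi 0 h0m t₁ ht₁)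
      (hi t₁ ht₁ 1 h1m)
    linarith [le_abs_self (F₁ + 2 * F₂), le_abs_self (2 * F₁ + 2 * F₂)]

theorem abs_U_eq (h : IsPendulum γ c p U) {k : ℝ} (hk : c ^ 2 = k * (2 * γ * p.Sx 1))
    (hσ : 0 < 2 * γ * p.Sx 1) {t : ℝ} (ht : t ∈ Set.Icc (0 : ℝ) 1) :
    0 ≤ k + Real.sin (2 * p.θ t) ∧
      |2 * U t| = 2 * Real.sqrt (2 * γ * p.Sx 1) * Real.sqrt (k + Real.sin (2 * p.θ t)) := by
  have hsq := h.U_sq ht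
  rw [hk] at hsq
  have e : U t ^ 2 = 2 * γ * p.Sx 1 * (k + Real.sin (2 * p.θ t)) := by linarith
  refine ⟨?_, ?_⟩
  · by_contra hn
    nlinarith [sq_nonneg (U t), mul_neg_of_pos_of_neg hσ (not_le.1 hn)]
  · rw [abs_mul, ← Real.sqrt_sq_eq_abs (U t), e, Real.sqrt_mul hσ.le, abs_of_pos two_pos]
    ring

end IsPendulum

/-! ### Lower bounds from the two metrics. -/

theorem mul_I₁_add_J₁ {k : ℝ} (h0 : 0 ≤ k) (h1 : k < 1) : k * I₁ k + J₁ k =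
    2 * (∫ x in (-Real.arcsin k)..0, Real.sqrt (k + Real.sin x)) +
      ∫ x in (0 : ℝ)..(Real.pi / 2), Real.sqrt (k + Real.sin x) := by
  have e : ∫ x in (-Real.arcsin k)..0, Real.sqrt (k + Real.sin x) =
      k * (∫ x in (-Real.arcsin k)..0, 1 / Real.sqrt (k + Real.sin x)) +
        ∫ x in (-Real.arcsin k)..0, Real.sin x / Real.sqrt (k + Real.sin x) := by
    rw [← intervalIntegral.integral_const_mul, ← intervalIntegral.integral_add
      ((intervalIntegrable_left h0 h1 (f := fun _ => 1) continuous_const).const_mul k)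
      (intervalIntegrable_left h0 h1 (f := fun s => s) continuous_id)]
    refine intervalIntegral.integral_congr fun x _ => ?_
    rw [mul_one_div, ← add_div, Real.div_sqrt]
  rw [integral_sqrt_sin_right h0, e]
  unfold I₁ J₁
  ring

theorem tendsto_integral_regularized {k a b : ℝ} (hab : a ≤ b)
    (hpos : ∀ x ∈ Set.Ioc a b, 0 < k + Real.sin x)
    (hi : IntervalIntegrable (fun x => 1 / Real.sqrt (k + Real.sin x)) volume a b) :
    Filter.Tendsto (fun ε => ∫ x in a..b, 1 / Real.sqrt (max (k + Real.sin x) 0 + ε))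
      (nhdsWithin 0 (Set.Ioi 0)) (nhds (∫ x in a..b, 1 / Real.sqrt (k + Real.sin x))) := by
  refine intervalIntegral.tendsto_integral_filter_of_dominated_convergence
    (fun x => 1 / Real.sqrt (k + Real.sin x)) ?_ ?_ hi ?_
  · refine Filter.Eventually.of_forall fun ε => Measurable.aestronglyMeasurable ?_
    fun_prop
  · filter_upwards [self_mem_nhdsWithin] with ε hε
    refine Filter.Eventually.of_forall fun x hx => ?_
    rw [Set.uIoc_of_le hab] at hx
    have := hpos x hx
    rw [Real.norm_of_nonneg (by positivity), max_eq_left this.le]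
    exact one_div_le_one_div_of_le (Real.sqrt_pos.2 this)
      (Real.sqrt_le_sqrt (by linarith [Set.mem_Ioi.1 hε]))
  · refine Filter.Eventually.of_forall fun x hx => ?_
    rw [Set.uIoc_of_le hab] at hx
    have := hpos x hx
    have hc : ContinuousAt (fun ε => 1 / Real.sqrt (max (k + Real.sin x) 0 + ε)) 0 := by
      refine ContinuousAt.div (by fun_prop) (by fun_prop) ?_
      rw [max_eq_left this.le, add_zero]
      exact (Real.sqrt_pos.2 this).ne'
    have ht := hc.tendsto.mono_left (nhdsWithin_le_nhds (s := Set.Ioi 0))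
    simp only [max_eq_left this.le, add_zero] at ht ⊢
    exact ht

namespace IsPendulum

variable {γ c : ℝ} {p : Trajectory} {U : ℝ → ℝ}

/-- In the metric `√(k + sin x) dx` the path has length `2√σ ∫ (k + sin 2θ) = 2√σ (k + Sx(1))`. -/
theorem mul_I₁_add_J₁_le (h : IsPendulum γ c p U) (hc : c < 0) {k : ℝ}
    (hk : c ^ 2 = k * (2 * γ * p.Sx 1)) (hk0 : 0 ≤ k) (hk1 : k < 1) :
    k * I₁ k + J₁ k ≤ Real.sqrt (2 * γ * p.Sx 1) * (k + p.Sx 1) := by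
  have hσ := (sq_nonneg c).trans_lt (h.sq_lt_of_neg hc)
  have hl := h.length_le hc hk hk0 (f := fun x => Real.sqrt (k + Real.sin x)) (by fun_prop)
    (fun x => Real.sqrt_nonneg _) (fun x => by rw [Real.sin_pi_sub])
  rw [← mul_I₁_add_J₁ hk0 hk1, intervalIntegral.integral_congr (g := fun t =>
    2 * Real.sqrt (2 * γ * p.Sx 1) * (k + Real.sin (2 * p.θ t))) (fun t ht => by
      rw [Set.uIcc_of_le zero_le_one] at ht
      have e := h.abs_U_eq hk hσ ht
      simp only
      rw [e.2, mul_left_comm, Real.mul_self_sqrt e.1]),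
    intervalIntegral.integral_const_mul, intervalIntegral.integral_add intervalIntegrable_const
      (h.intervalIntegrable_trig Real.continuous_sin), ← h.Sx_one] at hl
  simp only [intervalIntegral.integral_const, sub_zero, one_smul] at hl
  linarith

/-- In the metric `dx/√(k + sin x)` the path would have length `2√σ`, but the metric is singular at
the turning points. Adding `ε` under the root makes it continuous and the length at most `2√σ`; then
`ε → 0` by dominated convergence. -/
theorem I₁_le (h : IsPendulum γ c p U) (hc : c < 0) {k : ℝ}
    (hk : c ^ 2 = k * (2 * γ * p.Sx 1)) (hk0 : 0 ≤ k) (hk1 : k < 1) :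
    I₁ k ≤ Real.sqrt (2 * γ * p.Sx 1) := by
  have hσ := (sq_nonneg c).trans_lt (h.sq_lt_of_neg hc)
  have hpi := Real.pi_pos
  have hm0 := Real.arcsin_nonneg.2 hk0
  have hbound : ∀ ε ∈ Set.Ioi (0 : ℝ),
      2 * (∫ x in (-Real.arcsin k)..0, 1 / Real.sqrt (max (k + Real.sin x) 0 + ε)) +
        ∫ x in (0 : ℝ)..(Real.pi / 2), 1 / Real.sqrt (max (k + Real.sin x) 0 + ε) ≤
      Real.sqrt (2 * γ * p.Sx 1) := by
    intro ε hε
    have hpos : ∀ x, 0 < Real.sqrt (max (k + Real.sin x) 0 + ε) := fun x =>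
      Real.sqrt_pos.2 (add_pos_of_nonneg_of_pos (le_max_right _ _) hε)
    have hfc : Continuous fun x => 1 / Real.sqrt (max (k + Real.sin x) 0 + ε) :=
      continuous_const.div (by fun_prop) fun x => (hpos x).ne'
    have hl := h.length_le hc hk hk0 hfc (fun x => by positivity)
      (fun x => by rw [Real.sin_pi_sub])
    have hθc := h.continuousOn_θ
    have hUc := h.continuousOn_U
    have hle : ∫ t in (0 : ℝ)..1,
        1 / Real.sqrt (max (k + Real.sin (2 * p.θ t)) 0 + ε) * |2 * U t| ≤
        ∫ t in (0 : ℝ)..1, 2 * Real.sqrt (2 * γ * p.Sx 1) := by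
      refine intervalIntegral.integral_mono_on zero_le_one
        (ContinuousOn.intervalIntegrable ?_) intervalIntegrable_const fun t ht => ?_
      · rw [Set.uIcc_of_le zero_le_one]
        exact (hfc.comp_continuousOn (by fun_prop : ContinuousOn (fun t => 2 * p.θ t) _)).mul
          (by fun_prop)
      · have e := h.abs_U_eq hk hσ ht
        rw [e.2, one_div_mul_eq_div, div_le_iff₀ (hpos _)]
        refine mul_le_mul_of_nonneg_left (Real.sqrt_le_sqrt ?_) (by positivity)
        linarith [le_max_left (k + Real.sin (2 * p.θ t)) 0, Set.mem_Ioi.1 hε]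
    simp only [intervalIntegral.integral_const, sub_zero, one_smul] at hle
    linarith
  have ht1 := tendsto_integral_regularized (neg_nonpos.2 hm0) (fun x hx => ?_)
    (intervalIntegrable_left hk0 hk1 (f := fun _ => 1) continuous_const)
  · have ht2 := tendsto_integral_regularized Real.pi_div_two_pos.le
      (fun x hx => by linarith [sin_pos_of_mem hx]) (intervalIntegrable_I hk0)
    refine le_of_tendsto ((ht1.const_mul 2).add ht2) ?_
    filter_upwards [self_mem_nhdsWithin] with ε hε
    exact hbound ε hε
  · have := Real.sin_lt_sin_of_lt_of_le_pi_div_two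
      (neg_le_neg (Real.arcsin_le_pi_div_two k)) (hx.2.trans (by linarith)) hx.1
    rw [Real.sin_neg, Real.sin_arcsin (by linarith) hk1.le] at this
    linarith

/-- The lower bounds for the cost of an extremal with negative initial control. -/
theorem exists_cost_eq (h : IsPendulum γ c p U) (hγ : 0 < γ) (hc : c < 0) :
    ∃ k r : ℝ, 0 ≤ k ∧ k < 1 ∧ I₁ k ≤ r ∧ k * I₁ k + J₁ k ≤ r * (k + r ^ 2 / (2 * γ)) ∧
      cost γ p = k * r ^ 2 / 2 + 3 / (8 * γ) * r ^ 4 := by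
  have hlt := h.sq_lt_of_neg hc
  have hσ := (sq_nonneg c).trans_lt hlt
  have hk : c ^ 2 = c ^ 2 / (2 * γ * p.Sx 1) * (2 * γ * p.Sx 1) :=
    (div_mul_cancel₀ _ hσ.ne').symm
  have hk0 : 0 ≤ c ^ 2 / (2 * γ * p.Sx 1) := by positivity
  have hk1 : c ^ 2 / (2 * γ * p.Sx 1) < 1 := (div_lt_one hσ).2 hlt
  have hr := Real.sq_sqrt hσ.le
  have hX : p.Sx 1 = Real.sqrt (2 * γ * p.Sx 1) ^ 2 / (2 * γ) := by
    rw [hr]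
    field_simp
  have h1 := h.mul_I₁_add_J₁_le hc hk hk0 hk1
  have h2 := h.I₁_le hc hk hk0 hk1
  have h3 := h.cost_eq hγ
  refine ⟨_, _, hk0, hk1, h2, by rwa [← hX], ?_⟩
  rw [h3, show Real.sqrt (2 * γ * p.Sx 1) ^ 4 = (Real.sqrt (2 * γ * p.Sx 1) ^ 2) ^ 2 by ring,
    hr, ← hk]
  field_simp
  ring

end IsPendulum

end NotGate

end

/-! ### Comparison of the costs. -/

theorem proposition3p4 (γ : ℝ) (hγ : 0 ≤ γ) :
    (∃ q : NotGate.Trajectory, NotGate.IsSimplestExtremal γ q) ∧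
    ∀ q : NotGate.Trajectory, NotGate.IsSimplestExtremal γ q →
      ∀ (p : NotGate.Trajectory) (c : ℝ), NotGate.IsExtremal γ p →
        NotGate.HasInitialControl p c → c < 0 →
          NotGate.cost γ q ≤ NotGate.cost γ p := by
  refine ⟨NotGate.exists_isSimplestExtremal hγ, ?_⟩
  rintro q ⟨hq, cq, S, hparam, hcq, hS⟩ p c hp hpc hc
  obtain ⟨U, hU⟩ := hp.exists_isPendulum hpc
  rcases hγ.eq_or_lt with rfl | hpos
  · have := hU.initial_eq_of_zero
    linarith [Real.pi_pos]
  obtain ⟨V, hV⟩ := hq.exists_isPendulum hcq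
  obtain ⟨k, r, hk0, hk1, hIr, hM, hcost⟩ := hU.exists_cost_eq hpos hc
  have hI0 := NotGate.I_pos le_rfl
  -- This bound alone settles the weights up to `γc`.
  have hlow : 3 / (8 * γ) * NotGate.I 0 ^ 4 ≤ NotGate.cost γ p := by
    have h1 : NotGate.I 0 ^ 4 ≤ r ^ 4 :=
      pow_le_pow_left₀ hI0.le ((NotGate.I_zero_le_I₁ hk0 hk1).trans hIr) 4
    have h2 : 3 / (8 * γ) * NotGate.I 0 ^ 4 ≤ 3 / (8 * γ) * r ^ 4 :=
      mul_le_mul_of_nonneg_left h1 (by positivity)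
    have h3 : 0 ≤ k * r ^ 2 / 2 := by positivity
    linarith
  have hcostq := hV.cost_eq hpos
  rw [hS] at hcostq
  rcases hparam with ⟨rfl, -⟩ | ⟨-, -, l, hl, hlγ, rfl, rfl⟩ | ⟨hγc, rfl, rfl⟩ |
    ⟨-, l, hl0, hl1, hlγ, rfl, rfl⟩
  · exact absurd hpos (lt_irrefl 0)
  · refine le_trans (le_of_eq ?_) ((NotGate.cost_family_le hpos hl.le hlγ).trans hlow)
    have hI := NotGate.I_pos hl.le
    have e : NotGate.J l / NotGate.I l = NotGate.I l ^ 2 / (2 * γ) := by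
      field_simp
      linarith
    rw [hcostq, e, Real.sq_sqrt (by positivity)]
    field_simp
    ring
  · refine le_trans (le_of_eq ?_) hlow
    have hJ := NotGate.J_pos le_rfl
    have e : NotGate.J 0 / NotGate.I 0 = NotGate.I 0 ^ 2 / (2 * γ) := by
      rw [hγc, NotGate.γc]
      field_simp
    rw [hcostq, e]
    field_simp
    ring
  · have hR := NotGate.I₁_pos hl0.le hl1
    have hr : 0 < r := (NotGate.I₁_pos hk0 hk1).trans_le hIr
    have ht := NotGate.I₁_tangent hl0.le hl1 hk0 hk1
    have hJ : NotGate.J₁ l = NotGate.I₁ l ^ 3 / (2 * γ) := by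
      field_simp
      linarith
    set R := NotGate.I₁ l with hRdef
    rw [hcostq, hcost, neg_sq, Real.sq_sqrt (by positivity)]
    rw [hJ] at ht
    -- The tangent at `l` lies below `k I₁ + J₁`, hence below `r (k + r²/(2γ))`. After
    -- multiplication by `R`, the mixed terms `R r k` and `R r³` are absorbed by `2Rr ≤ R² + r²` and
    -- `4R r³ ≤ R⁴ + 3r⁴`.
    have h1 := mul_le_mul_of_nonneg_left (ht.trans hM) hR.le
    have h2 : 0 ≤ (R - r) ^ 2 * k := mul_nonneg (sq_nonneg _) hk0
    have h3 : 0 ≤ (R ^ 4 + 3 * r ^ 4 - 4 * R * r ^ 3) / (8 * γ) := by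
      refine div_nonneg ?_ (by positivity)
      have : R ^ 4 + 3 * r ^ 4 - 4 * R * r ^ 3 =
          (R - r) ^ 2 * ((R + r) ^ 2 + 2 * r ^ 2) := by ring
      rw [this]
      positivity
    have e1 : 3 / 2 * γ * (R ^ 2 / (2 * γ)) ^ 2 = 3 * R ^ 4 / (8 * γ) := by
      field_simp
      ring
    have e2 : R * (l * R + R ^ 3 / (2 * γ) + R / 2 * (k - l)) =
      l * R ^ 2 + 4 * R ^ 4 / (8 * γ) + R ^ 2 / 2 * (k - l) := by
      field_simp
      ring
    have e3 : R * (r * (k + r ^ 2 / (2 * γ))) = R * r * k + 4 * R * r ^ 3 / (8 * γ) := by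
      field_simp
      ring
    have e4 : (R ^ 4 + 3 * r ^ 4 - 4 * R * r ^ 3) / (8 * γ) =
      R ^ 4 / (8 * γ) + 3 * r ^ 4 / (8 * γ) - 4 * R * r ^ 3 / (8 * γ) := by ring
    have e5 : 3 / (8 * γ) * r ^ 4 = 3 * r ^ 4 / (8 * γ) := by ring
    have e6 : 4 * R ^ 4 / (8 * γ) = R ^ 4 / (8 * γ) + 3 * R ^ 4 / (8 * γ) := by ring
    rw [e2, e3, e6] at h1
    rw [e4] at h3
    rw [e1, e5]
    nlinarith
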